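/- An instance of Colorful Path-Cover consists of a forest $F$ on $n$ vertices, a set $B\subseteq V(F)$, an integer $\ell\ge 0$, and $t$ families $\mathcal F_1,\dots,\mathcal F_t$ of paths of $F$ (a path may be a single vertex and has no orientation) such that for $i\neq j$ no vertex lies both on a path of $\mathcal F_i$ and on a path of $\mathcal F_j$. The question is whether there is a set $\mathcal P$ of $t$ paths such that $|\mathcal P\cap\mathcal F_i|=1$ for every $i\in\{1,\dots,t\}$, and for every $v\in B$ there are a path $P\in\mathcal P$ and a vertex $u\in V(P)$ with $d_F(u,v)\le\ell$ (vertices in different trees have infinite distance). There is a single algorithm (a program of a unit-cost random access machine with addition, truncated subtraction, comparison and indirect addressing on natural numbers) that decides Colorful Path-Cover and, on all instances in which $F$ has $O(k)$ trees and the number of families satisfies $t=O(k)$, runs in time $O(\ell^2\cdot 2^{O(k\log k)}\cdot n^{O(1)})$. Precisely, there is an exponent $d$ such that for every $a\in\mathbb N$ there is a constant $C$ such that, for every $k\in\mathbb N$ and every instance whose forest has at most $ak$ trees and for which $t\le ak$, the algorithm halts with the correct answer after at most $C\cdot\max(1,\ell)^2\cdot 2^{C k\log k}\cdot\max(1,n)^{d}$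 steps (with $0\log 0=0$). The input consists of $n$, $\ell$, $t$, the adjacency matrix of $F$, the characteristic vector of $B$, and, for each family, the $0$-$1$ matrix of the pairs of end vertices of its paths (which determine the paths, as $F$ is a forest). -/

import Mathlib

namespace PathCover

/-! ## The machine model: structured programs for a random access machine

A machine has scalar variables and one-dimensional arrays, all holding natural numbers (a program
text mentions only finitely many of each). The primitive operations are those of the standard
unit-cost RAM: constants, copying, addition, truncated subtraction, comparison, indirect reads and
writes. There is no multiplication, so that numbers grow by at most one bit per operation. -/

/-- Expressions; comparisons return `1` for true and `0` for false. -/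
inductive Expr where
  | lit (c : ℕ)
  | var (x : ℕ)
  | get (a : ℕ) (i : Expr)
  | add (e f : Expr)
  | sub (e f : Expr)
  | lt (e f : Expr)
  | eq (e f : Expr)

/-- Programs. `get`/`store` access the array named `a` at a computed index. -/
inductive Prog where
  | skip
  | assign (x : ℕ) (e : Expr)
  | store (a : ℕ) (i e : Expr)
  | seq (p q : Prog)
  | cond (e : Expr) (p q : Prog)
  | loop (e : Expr) (p : Prog)

/-- A memory state: the values of the variables and the contents of the arrays. -/
structure State where
  var : ℕ → ℕ
  arr : ℕ → ℕ → ℕ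

/-- The value of an expression in a state. -/
def Expr.eval (s : State) : Expr → ℕ
  | .lit c => c
  | .var x => s.var x
  | .get a i => s.arr a (i.eval s)
  | .add e f => e.eval s + f.eval s
  | .sub e f => e.eval s - f.eval s
  | .lt e f => if e.eval s < f.eval s then 1 else 0
  | .eq e f => if e.eval s = f.eval s then 1 else 0

/-- The number of primitive operations performed when an expression is evaluated. -/
def Expr.cost : Expr → ℕ
  | .lit _ => 1
  | .var _ => 1
  | .get _ i => i.cost + 1
  | .add e f => e.cost + f.cost + 1
  | .sub e f => e.cost + f.cost + 1
  | .lt e f => e.cost + f.cost + 1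
  | .eq e f => e.cost + f.cost + 1

/-- `s.setVar x v`: variable `x` is overwritten by `v`. -/
def State.setVar (s : State) (x v : ℕ) : State :=
  { s with var := Function.update s.var x v }

/-- `s.setArr a i v`: entry `i` of array `a` is overwritten by `v`. -/
def State.setArr (s : State) (a i v : ℕ) : State :=
  { s with arr := Function.update s.arr a (Function.update (s.arr a) i v) }

/-- `p.Run s s' T`: started in state `s`, the program `p` halts in state `s'` after exactly `T`
steps. A condition holds if its value is not `0`; a loop that never ends has no run. -/
inductive Prog.Run : Prog → State → State → ℕ → Prop where
  | skip (s : State) : Run .skip s s 1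
  | assign (s : State) (x : ℕ) (e : Expr) :
      Run (.assign x e) s (s.setVar x (e.eval s)) (e.cost + 1)
  | store (s : State) (a : ℕ) (i e : Expr) :
      Run (.store a i e) s (s.setArr a (i.eval s) (e.eval s)) (i.cost + e.cost + 1)
  | seq {p q : Prog} {s₁ s₂ s₃ : State} {T U : ℕ} (hp : Run p s₁ s₂ T) (hq : Run q s₂ s₃ U) :
      Run (.seq p q) s₁ s₃ (T + U)
  | cond_true {e : Expr} {p q : Prog} {s s' : State} {T : ℕ} (he : e.eval s ≠ 0)
      (hp : Run p s s' T) : Run (.cond e p q) s s' (e.cost + 1 + T)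
  | cond_false {e : Expr} {p q : Prog} {s s' : State} {T : ℕ} (he : e.eval s = 0)
      (hq : Run q s s' T) : Run (.cond e p q) s s' (e.cost + 1 + T)
  | loop_stop {e : Expr} {p : Prog} {s : State} (he : e.eval s = 0) :
      Run (.loop e p) s s (e.cost + 1)
  | loop_step {e : Expr} {p : Prog} {s₁ s₂ s₃ : State} {T U : ℕ} (he : e.eval s₁ ≠ 0)
      (hp : Run p s₁ s₂ T) (hl : Run (.loop e p) s₂ s₃ U) :
      Run (.loop e p) s₁ s₃ (e.cost + 1 + T + U)

/-- The initial state on the input `w`: the word is in array `0`, its length in variable `0`, and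
everything else is `0`. -/
def State.init (w : List ℕ) : State where
  var := Function.update 0 0 w.length
  arr := Function.update 0 0 (fun i => w.getD i 0)

/-! ## The problem Colorful Path-Cover -/

/-- A subgraph that is a path (possibly a single vertex); paths have no orientation. -/
def IsPathSubgraph {V : Type*} {G : SimpleGraph V} (P : G.Subgraph) : Prop :=
  ∃ (u v : V) (p : G.Walk u v), p.IsPath ∧ P = p.toSubgraph

/-- Instances: a forest `F` with `n` vertices, a set `B` of vertices, a radius `ℓ`, and `t`
families of paths of `F`, where paths of different families have no vertex in common. -/
structure Instance where
  n : ℕ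
  F : SimpleGraph (Fin n)
  isForest : F.IsAcyclic
  B : Set (Fin n)
  ℓ : ℕ
  t : ℕ
  family : Fin t → Set F.Subgraph
  family_path : ∀ i, ∀ P ∈ family i, IsPathSubgraph P
  family_disjoint : ∀ i j, i ≠ j → ∀ P ∈ family i, ∀ Q ∈ family j, Disjoint P.verts Q.verts

/-- The question: is there a set `S` of `t` paths, exactly one of them from each family, such that
every vertex of `B` is at distance at most `ℓ` from a vertex of a path of `S`? (`edist` is `⊤`
between different trees.) -/
def Instance.IsYes (I : Instance) : Prop :=
  ∃ S : Set I.F.Subgraph,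
    (∀ P ∈ S, IsPathSubgraph P) ∧ S.ncard = I.t ∧
    (∀ i, (S ∩ I.family i).ncard = 1) ∧
    ∀ v ∈ I.B, ∃ P ∈ S, ∃ u ∈ P.verts, I.F.edist u v ≤ (I.ℓ : ℕ∞)

/-- The number of trees of the forest. -/
noncomputable def Instance.numTrees (I : Instance) : ℕ :=
  Nat.card I.F.ConnectedComponent

open Classical in
/-- The truth value of a proposition as a number. -/
noncomputable def bit (p : Prop) : ℕ := if p then 1 else 0

/-- The encoding of an instance: `n`, `ℓ`, `t`, the adjacency matrix of `F`, the characteristic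
vector of `B`, and for each family the 0-1 matrix of the pairs of end vertices of its paths (in a
forest a path is determined by its end vertices). -/
noncomputable def Instance.encode (I : Instance) : List ℕ :=
  [I.n, I.ℓ, I.t] ++
  ((List.finRange I.n).flatMap fun u => (List.finRange I.n).map fun v => bit (I.F.Adj u v)) ++
  ((List.finRange I.n).map fun v => bit (v ∈ I.B)) ++
  ((List.finRange I.t).flatMap fun i => (List.finRange I.n).flatMap fun u =>
    (List.finRange I.n).map fun v =>
      bit (∃ p : I.F.Walk u v, p.IsPath ∧ p.toSubgraph ∈ I.family i))

end PathCover

namespace PathCover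

/-! ## Total correctness of programs with a bound on the number of steps -/

/-! In a forest, a vertex `v` is within distance `ℓ` of the path from `x` to `y` in its tree exactly
if `d(v,x) + d(v,y) - d(x,y) ≤ 2ℓ` (`exists_mem_support_edist_le`, `dist_add_dist_le_of_edist_le`),
so covering can be tested from distances to the two ends.

A solution is recorded as a labeling. Each vertex carries the ordered ends `(x, y)` of a nearest
chosen path in its tree, ties being broken by the index of the family, or a dummy label if its tree
contains no chosen path. Stepping from a vertex towards the `x` of its label does not change the
label; this local rule uses that paths of different families are disjoint. Conversely, the local
rule alone transports a label to the vertex `x` itself (`label_start_eq`), so a path in use can be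
charged once, at its first end. The charge of a path of family `i` is `2^i + 2^t`, and a multiset of
charges sums to `target t` only if every family is charged exactly once (`eq_one_of_sum_weight`).
Hence the problem is a constraint problem on the edges of a forest with one prescribed total weight
(`Instance.isYes_iff`).

Such a problem is solved by variable elimination: a vertex with at most one remaining neighbor is
merged into that neighbor (`solvable_erase_iff`), and the last vertex of each tree is merged into an
additional vertex `n`. Since `target t < 4^t`, a table with `4^t * (n+1)^2` entries per vertex
suffices.

For the running time, the algorithm is written in a small language of bounded sums and array updates
whose variables never exceed `I.size = 4^t * (n+1)^2` (`Cmd.exec_var_le`). Compilation costs a fixed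
power of this bound (`Tm.exists_correct`, `Cmd.exists_correct`); the radius is only added and
compared and never bounds a loop. Finally `t ≤ a * k` turns `4^(t*d)` into `2^(O(k log k))`
(`four_pow_le`). -/

/-- Started in `s`, the program `p` halts within `B` steps in a state satisfying `Q`. -/
def Prog.Spec (p : Prog) (s : State) (B : ℕ) (Q : State → Prop) : Prop :=
  ∃ s' T, p.Run s s' T ∧ T ≤ B ∧ Q s'

theorem Prog.Spec.mono {p : Prog} {s : State} {B C : ℕ} {Q R : State → Prop}
    (h : p.Spec s B Q) (hBC : B ≤ C) (hQR : ∀ s', Q s' → R s') : p.Spec s C R := by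
  obtain ⟨s', T, hr, hT, hq⟩ := h
  exact ⟨s', T, hr, hT.trans hBC, hQR _ hq⟩

theorem Prog.Spec.assign {x : ℕ} {e : Expr} {s : State} {Q : State → Prop}
    (h : Q (s.setVar x (e.eval s))) : (Prog.assign x e).Spec s (e.cost + 1) Q :=
  ⟨_, _, .assign s x e, le_rfl, h⟩

theorem Prog.Spec.store {a : ℕ} {i e : Expr} {s : State} {Q : State → Prop}
    (h : Q (s.setArr a (i.eval s) (e.eval s))) :
    (Prog.store a i e).Spec s (i.cost + e.cost + 1) Q :=
  ⟨_, _, .store s a i e, le_rfl, h⟩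

theorem Prog.Spec.seq {p q : Prog} {s : State} {B C : ℕ} {Q R : State → Prop}
    (hp : p.Spec s B R) (hq : ∀ s', R s' → q.Spec s' C Q) : (p.seq q).Spec s (B + C) Q := by
  obtain ⟨s', T, hr, hT, h⟩ := hp
  obtain ⟨s'', U, hr', hU, h'⟩ := hq s' h
  exact ⟨s'', T + U, .seq hr hr', by omega, h'⟩

theorem Prog.Spec.cond {e : Expr} {p q : Prog} {s : State} {B : ℕ} {Q : State → Prop}
    (hp : e.eval s ≠ 0 → p.Spec s B Q) (hq : e.eval s = 0 → q.Spec s B Q) :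
    (Prog.cond e p q).Spec s (e.cost + 1 + B) Q := by
  by_cases he : e.eval s = 0
  · obtain ⟨s', T, hr, hT, h⟩ := hq he
    exact ⟨s', _, .cond_false he hr, by omega, h⟩
  · obtain ⟨s', T, hr, hT, h⟩ := hp he
    exact ⟨s', _, .cond_true he hr, by omega, h⟩

/-- A loop with a family of invariants `I i`, where `i` counts the iterations. -/
theorem Prog.Spec.loop {e : Expr} {p : Prog} (I : ℕ → State → Prop) (k B : ℕ)
    (hstep : ∀ i < k, ∀ s, I i s → e.eval s ≠ 0 ∧ p.Spec s B (I (i + 1)))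
    (hdone : ∀ s, I k s → e.eval s = 0) {s : State} (h0 : I 0 s) :
    (Prog.loop e p).Spec s ((k + 1) * (B + e.cost + 1)) (I k) := by
  -- The induction is on the number `j` of iterations still to come, because `loop_step` peels off
  -- the first iteration.
  suffices H : ∀ j ≤ k, ∀ s, I (k - j) s →
      (Prog.loop e p).Spec s ((j + 1) * (B + e.cost + 1)) (I k) from
    H k le_rfl s (by simpa using h0)
  intro j
  induction j with
  | zero =>
    intro _ s hs
    exact ⟨s, e.cost + 1, by constructor; exact hdone s (by simpa using hs), by simp, by simpa using hs⟩
  | succ j ih =>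
    intro hj s hs
    obtain ⟨he, s', T, hr, hT, hI⟩ := hstep (k - (j + 1)) (by omega) s hs
    rw [show k - (j + 1) + 1 = k - j by omega] at hI
    obtain ⟨s'', U, hr', hU, hk⟩ := ih (by omega) s' hI
    refine ⟨s'', _, .loop_step he hr hr', ?_, hk⟩
    have : (j + 1 + 1) * (B + e.cost + 1) = (j + 1) * (B + e.cost + 1) + (B + e.cost + 1) := by ring
    omega

@[simp] theorem State.setVar_var (s : State) (x v y : ℕ) :
    (s.setVar x v).var y = if y = x then v else s.var y := by
  simp [State.setVar, Function.update_apply]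

@[simp] theorem State.setVar_arr (s : State) (x v : ℕ) : (s.setVar x v).arr = s.arr := rfl

theorem State.setArr_arr (s : State) (a i v b : ℕ) :
    (s.setArr a i v).arr b = if b = a then Function.update (s.arr a) i v else s.arr b := by
  simp only [State.setArr, Function.update_apply]

theorem State.setVar_setVar (s : State) (x v w : ℕ) :
    (s.setVar x v).setVar x w = s.setVar x w := by
  simp [State.setVar]

/-! ## Polynomially bounded functions -/

/-- `f` is bounded by a power of its argument, for arguments that are at least `2`. -/
def PolyBdd (f : ℕ → ℕ) : Prop := ∃ d, ∀ X ≥ 2, f X ≤ X ^ d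

/-- As arguments are at least `2`, constants are absorbed into the exponent: `c ≤ 2^c ≤ X^c`. -/
theorem PolyBdd.const (c : ℕ) : PolyBdd fun _ => c :=
  ⟨c, fun _ hX => Nat.lt_two_pow_self.le.trans (Nat.pow_le_pow_left hX c)⟩

theorem PolyBdd.id : PolyBdd fun X => X := ⟨1, by simp⟩

theorem PolyBdd.mul {f g : ℕ → ℕ} (hf : PolyBdd f) (hg : PolyBdd g) :
    PolyBdd fun X => f X * g X := by
  obtain ⟨a, ha⟩ := hf
  obtain ⟨b, hb⟩ := hg
  exact ⟨a + b, fun X hX => by rw [pow_add]; exact Nat.mul_le_mul (ha X hX) (hb X hX)⟩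

theorem PolyBdd.add {f g : ℕ → ℕ} (hf : PolyBdd f) (hg : PolyBdd g) :
    PolyBdd fun X => f X + g X := by
  obtain ⟨a, ha⟩ := hf
  obtain ⟨b, hb⟩ := hg
  refine ⟨a + b + 1, fun X hX => ?_⟩
  have h1 : X ^ a ≤ X ^ (a + b) := Nat.pow_le_pow_right (by omega) (by omega)
  have h2 : X ^ b ≤ X ^ (a + b) := Nat.pow_le_pow_right (by omega) (by omega)
  have h3 : X ^ (a + b) * 2 ≤ X ^ (a + b + 1) := by
    rw [pow_succ]; exact Nat.mul_le_mul_left _ hX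
  have := ha X hX
  have := hb X hX
  change f X + g X ≤ _
  omega

/-! ## Terms with bounded sums and their compilation -/

/-- Terms over variables and arrays. `sum x b e` sums `e` over the values `0, 1, ...` of `x` below
the value of the variable `b`; `mul e x` multiplies by the value of a variable. -/
inductive Tm where
  | lit (c : ℕ)
  | var (x : ℕ)
  | get (a : ℕ) (i : Tm)
  | add (e f : Tm)
  | sub (e f : Tm)
  | lt (e f : Tm)
  | eq (e f : Tm)
  | mul (e : Tm) (x : ℕ)
  | ite (c e f : Tm)
  | sum (x b : ℕ) (e : Tm)

/-- The value of a term. -/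
def Tm.eval : Tm → State → ℕ
  | .lit c, _ => c
  | .var x, s => s.var x
  | .get a i, s => s.arr a (i.eval s)
  | .add e f, s => e.eval s + f.eval s
  | .sub e f, s => e.eval s - f.eval s
  | .lt e f, s => if e.eval s < f.eval s then 1 else 0
  | .eq e f, s => if e.eval s = f.eval s then 1 else 0
  | .mul e x, s => e.eval s * s.var x
  | .ite c e f, s => if c.eval s ≠ 0 then e.eval s else f.eval s
  | .sum x b e, s => ∑ i ∈ Finset.range (s.var b), e.eval (s.setVar x i)

/-- The program `compile e r` leaves the value of `e` in the machine variable `2 * r`. The variables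
of terms are the odd machine variables, the arrays of terms are the even machine arrays. -/
def Tm.compile : Tm → ℕ → Prog
  | .lit c, r => .assign (2 * r) (.lit c)
  | .var x, r => .assign (2 * r) (.var (2 * x + 1))
  | .get a i, r => .seq (i.compile r) (.assign (2 * r) (.get (2 * a) (.var (2 * r))))
  | .add e f, r => .seq (e.compile r) (.seq (f.compile (r + 1))
      (.assign (2 * r) (.add (.var (2 * r)) (.var (2 * (r + 1))))))
  | .sub e f, r => .seq (e.compile r) (.seq (f.compile (r + 1))
      (.assign (2 * r) (.sub (.var (2 * r)) (.var (2 * (r + 1))))))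
  | .lt e f, r => .seq (e.compile r) (.seq (f.compile (r + 1))
      (.assign (2 * r) (.lt (.var (2 * r)) (.var (2 * (r + 1))))))
  | .eq e f, r => .seq (e.compile r) (.seq (f.compile (r + 1))
      (.assign (2 * r) (.eq (.var (2 * r)) (.var (2 * (r + 1))))))
  | .mul e x, r => .seq (e.compile r) (.seq (.assign (2 * (r + 1)) (.lit 0))
      (.seq (.assign (2 * (r + 2)) (.lit 0))
      (.seq (.loop (.lt (.var (2 * (r + 2))) (.var (2 * x + 1)))
        (.seq (.assign (2 * (r + 1)) (.add (.var (2 * (r + 1))) (.var (2 * r))))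
          (.assign (2 * (r + 2)) (.add (.var (2 * (r + 2))) (.lit 1)))))
      (.assign (2 * r) (.var (2 * (r + 1)))))))
  | .ite c e f, r => .seq (c.compile r) (.cond (.var (2 * r)) (e.compile r) (f.compile r))
  | .sum x b e, r => .seq (.assign (2 * r) (.lit 0)) (.seq (.assign (2 * (r + 1)) (.var (2 * b + 1)))
      (.seq (.assign (2 * (r + 2)) (.var (2 * x + 1))) (.seq (.assign (2 * x + 1) (.lit 0))
      (.seq (.loop (.lt (.var (2 * x + 1)) (.var (2 * (r + 1))))
        (.seq (e.compile (r + 3)) (.seq (.assign (2 * r) (.add (.var (2 * r)) (.var (2 * (r + 3)))))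
          (.assign (2 * x + 1) (.add (.var (2 * x + 1)) (.lit 1))))))
      (.assign (2 * x + 1) (.var (2 * (r + 2))))))))

/-- The machine state `s` represents the state `σ` of the term language. -/
def Rep (s σ : State) : Prop := (∀ x, s.var (2 * x + 1) = σ.var x) ∧ ∀ a, s.arr (2 * a) = σ.arr a

/-- Only even variables from `2 * r` on differ. -/
def Frame (r : ℕ) (s s' : State) : Prop :=
  s'.arr = s.arr ∧ (∀ x, s'.var (2 * x + 1) = s.var (2 * x + 1)) ∧ ∀ k < r, s'.var (2 * k) = s.var (2 * k)

theorem Rep.frame {r : ℕ} {s s' σ : State} (h : Rep s σ) (hf : Frame r s s') : Rep s' σ :=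
  ⟨fun x => (hf.2.1 x).trans (h.1 x), fun a => by rw [hf.1]; exact h.2 a⟩

theorem Frame.trans {r q : ℕ} {s s' s'' : State} (h : Frame r s s') (h' : Frame q s' s'')
    (hq : r ≤ q) : Frame r s s'' :=
  ⟨h'.1.trans h.1, fun x => (h'.2.1 x).trans (h.2.1 x),
    fun k hk => (h'.2.2 k (by omega)).trans (h.2.2 k hk)⟩

theorem Frame.refl (r : ℕ) (s : State) : Frame r s s := ⟨rfl, fun _ => rfl, fun _ _ => rfl⟩

theorem Frame.setVar {r : ℕ} {s s' : State} (h : Frame r s s') {q : ℕ} (hq : r ≤ q) (v : ℕ) :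
    Frame r s (s'.setVar (2 * q) v) :=
  ⟨h.1, fun x => by rw [State.setVar_var, if_neg (by omega)]; exact h.2.1 x,
    fun k hk => by rw [State.setVar_var, if_neg (by omega)]; exact h.2.2 k hk⟩

/-- The compiled term computes its value in polynomial time. -/
def Tm.Correct (e : Tm) (f : ℕ → ℕ) : Prop :=
  ∀ (r X : ℕ) (s σ : State), Rep s σ → (∀ x, σ.var x + 2 ≤ X) →
    (e.compile r).Spec s (f X) fun s' => s'.var (2 * r) = e.eval σ ∧ Frame r s s'

/-- The right operand is evaluated in registers from `r + 1` on, so its `Frame` protects the left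
value in register `r`. -/
theorem Tm.Correct.binary {e f g : Tm} {a b : ℕ → ℕ} (he : e.Correct a) (hf : f.Correct b)
    (op : Expr → Expr → Expr) (v : ℕ → ℕ → ℕ)
    (hc : ∀ r, g.compile r = .seq (e.compile r) (.seq (f.compile (r + 1))
      (.assign (2 * r) (op (.var (2 * r)) (.var (2 * (r + 1)))))))
    (hcost : ∀ x y, (op (.var x) (.var y)).cost = 3)
    (hop : ∀ s x y, (op (.var x) (.var y)).eval s = v (s.var x) (s.var y))
    (hg : ∀ s, g.eval s = v (e.eval s) (f.eval s)) :
    g.Correct fun X => a X + (b X + 4) := by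
  intro r X s σ hs hX
  rw [hc]
  refine .seq (he r X s σ hs hX) fun s₁ h₁ => .seq (hf (r + 1) X s₁ σ (hs.frame h₁.2) hX)
    fun s₂ h₂ => .mono (.assign ?_) (by rw [hcost]) fun _ h => h
  refine ⟨?_, ((h₁.2.trans h₂.2 (by omega)).setVar le_rfl _)⟩
  rw [State.setVar_var, if_pos rfl, hop, hg, h₂.1, h₂.2.2.2 r (by omega), h₁.1]

/-- Repeated addition. The multiplier has to be a variable since only variables, not values of
terms, are bounded by `X`. -/
theorem Tm.Correct.mul {e : Tm} {a : ℕ → ℕ} (he : e.Correct a) (x : ℕ) :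
    (Tm.mul e x).Correct fun X => a X + (2 + (2 + ((X + 1) * 20 + 2))) := by
  intro r X s σ hs hX
  refine .seq (he r X s σ hs hX) fun s₁ h₁ => .seq (.assign (Q := fun s' =>
    s'.var (2 * r) = e.eval σ ∧ s'.var (2 * (r + 1)) = 0 ∧ Frame r s s') ?_) fun s₂ h₂ =>
    .seq (.assign (Q := fun s' => s'.var (2 * r) = e.eval σ ∧ s'.var (2 * (r + 1)) = 0 ∧
      s'.var (2 * (r + 2)) = 0 ∧ Frame r s s') ?_) fun s₃ h₃ =>
    .seq (.mono (.loop (fun i s' => s'.var (2 * r) = e.eval σ ∧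
      s'.var (2 * (r + 1)) = e.eval σ * i ∧ s'.var (2 * (r + 2)) = i ∧ Frame r s s') (σ.var x) 8
      ?_ ?_ ?_) ?_ fun _ h => h) fun s₄ h₄ => .assign ?_
  · exact ⟨by simp [h₁.1], by simp [Expr.eval], h₁.2.setVar (by omega) _⟩
  · exact ⟨by simp [h₂.1], by simp [h₂.2.1], by simp [Expr.eval], h₂.2.2.setVar (by omega) _⟩
  · intro i hi s' h
    have hx : s'.var (2 * x + 1) = σ.var x := (hs.frame h.2.2.2).1 x
    refine ⟨by simp [Expr.eval, h.2.2.1, hx, hi], .seq (B := 4) (C := 4) (.assign (Q := fun s' =>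
      s'.var (2 * r) = e.eval σ ∧ s'.var (2 * (r + 1)) = e.eval σ * (i + 1) ∧
      s'.var (2 * (r + 2)) = i ∧ Frame r s s') ?_) fun s'' h' => .assign ?_⟩
    · exact ⟨by simp [h.1], by
        rw [Nat.mul_succ (e.eval σ) i]; simp only [State.setVar_var, if_true, Expr.eval, h.1, h.2.1], by simp [h.2.2.1],
        h.2.2.2.setVar (by omega) _⟩
    · exact ⟨by simp [h'.1], by simp [h'.2.1], by simp [Expr.eval, h'.2.2.1],
        h'.2.2.2.setVar (by omega) _⟩
  · intro s' h
    have hx : s'.var (2 * x + 1) = σ.var x := (hs.frame h.2.2.2).1 x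
    simp [Expr.eval, h.2.2.1, hx]
  · simpa using h₃
  · have := hX x
    simp only [Expr.cost]
    exact Nat.mul_le_mul (by omega) (by omega)
  · exact ⟨by simp [Expr.eval, h₄.2.1, Tm.eval], h₄.2.2.2.setVar le_rfl _⟩

/-- The bound and the old value of `x` are saved in registers before `x` is reset, so `x = b` is
harmless. During the loop the odd variable `x` differs from its value in `σ`; the invariant
therefore states `Frame` for the state in which `x` has been restored. -/
theorem Tm.Correct.sum {e : Tm} {a : ℕ → ℕ} (he : e.Correct a) (x b : ℕ) :
    (Tm.sum x b e).Correct fun X => 2 + (2 + (2 + (2 + ((X + 1) * (a X + 12) + 2)))) := by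
  intro r X s σ hs hX
  refine .seq (.assign (Q := fun s' => s'.var (2 * r) = 0 ∧ Frame r s s') ?_) fun s₁ h₁ =>
    .seq (.assign (Q := fun s' => s'.var (2 * r) = 0 ∧ s'.var (2 * (r + 1)) = σ.var b ∧
      Frame r s s') ?_) fun s₂ h₂ =>
    .seq (.assign (Q := fun s' => s'.var (2 * r) = 0 ∧ s'.var (2 * (r + 1)) = σ.var b ∧
      s'.var (2 * (r + 2)) = σ.var x ∧ Frame r s s') ?_) fun s₃ h₃ =>
    .seq (.assign (Q := fun s' => s'.var (2 * r) = 0 ∧ s'.var (2 * (r + 1)) = σ.var b ∧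
      s'.var (2 * (r + 2)) = σ.var x ∧ s'.var (2 * x + 1) = 0 ∧ Frame r s (s'.setVar (2 * x + 1) (σ.var x))) ?_) fun s₄ h₄ =>
    .seq (.mono (.loop (fun i s' => s'.var (2 * r) = ∑ j ∈ Finset.range i, e.eval (σ.setVar x j) ∧
      s'.var (2 * (r + 1)) = σ.var b ∧ s'.var (2 * (r + 2)) = σ.var x ∧ s'.var (2 * x + 1) = i ∧
      Frame r s (s'.setVar (2 * x + 1) (σ.var x))) (σ.var b) (a X + 8)
      ?_ ?_ ?_) ?_ fun _ h => h) fun s₄ h₄ => .assign ?_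
  · exact ⟨by simp [Expr.eval], (Frame.refl r s).setVar le_rfl _⟩
  · exact ⟨by simp [h₁.1], by simp [Expr.eval, (hs.frame h₁.2).1], h₁.2.setVar (by omega) _⟩
  · exact ⟨by simp [h₂.1], by simp [h₂.2.1], by simp [Expr.eval, (hs.frame h₂.2.2).1],
      h₂.2.2.setVar (by omega) _⟩
  · have e1 : 2 * r ≠ 2 * x + 1 := by omega
    have e2 : 2 * (r + 1) ≠ 2 * x + 1 := by omega
    have e3 : 2 * (r + 2) ≠ 2 * x + 1 := by omega
    refine ⟨by simp [h₃.1, e1], by simp [h₃.2.1, e2], by simp [h₃.2.2.1, e3], by simp [Expr.eval], ?_⟩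
    rw [State.setVar_setVar]
    refine ⟨h₃.2.2.2.1, fun y => ?_, fun k hk => ?_⟩
    · rw [State.setVar_var]
      split_ifs with hy
      · rw [hy, hs.1]
      · exact h₃.2.2.2.2.1 y
    · rw [State.setVar_var, if_neg (by omega)]
      exact h₃.2.2.2.2.2 k hk
  · intro i hi s' ⟨g1, g2, g3, g4, g5⟩
    refine ⟨by simp [Expr.eval, g4, g2, hi], ?_⟩
    have hrep : Rep s' (σ.setVar x i) := by
      refine ⟨fun y => ?_, fun c => ?_⟩
      · rw [State.setVar_var]
        split_ifs with hy
        · rw [hy, g4]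
        · have := g5.2.1 y
          rw [State.setVar_var, if_neg (by omega)] at this
          rw [this, hs.1]
      · have := g5.1
        simp only [State.setVar_arr] at this ⊢
        rw [this, hs.2]
    refine .mono (.seq (he (r + 3) X s' _ hrep fun y => ?_) fun s₁ h₁ => .seq (B := 4) (C := 4)
      (.assign (Q := fun s₂ => s₂.var (2 * r) = ∑ j ∈ Finset.range (i + 1), e.eval (σ.setVar x j) ∧
        Frame r (s'.setVar (2 * r) (s₂.var (2 * r))) s₂ ∧ s₂.var (2 * (r + 1)) = σ.var b ∧ s₂.var (2 * (r + 2)) = σ.var x) ?_)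
        fun s₂ h₂ => .assign ?_) (by omega) fun _ h => h
    · rw [State.setVar_var]
      split_ifs
      · have := hX b
        omega
      · exact hX y
    · obtain ⟨k1, k2, k3, k4⟩ := h₁
      refine ⟨?_, ⟨?_, fun y => ?_, fun k hk => ?_⟩, ?_, ?_⟩
      · simp [Expr.eval, k1, k4 r (by omega), g1, Finset.sum_range_succ]
      · simp [k2]
      · simp only [State.setVar_var]
        rw [if_neg (by omega), if_neg (by omega)]
        exact k3 y
      · simp only [State.setVar_var]
        rw [if_neg (by omega), if_neg (by omega)]
        exact k4 k (by omega)
      · rw [State.setVar_var, if_neg (by omega), k4 _ (by omega), g2]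
      · rw [State.setVar_var, if_neg (by omega), k4 _ (by omega), g3]
    · obtain ⟨k1, k2, k3, k4⟩ := h₂
      refine ⟨?_, ?_, ?_, ?_, ?_⟩
      · rw [State.setVar_var, if_neg (by omega), k1]
      · rw [State.setVar_var, if_neg (by omega), k3]
      · rw [State.setVar_var, if_neg (by omega), k4]
      · have := k2.2.1 x
        rw [State.setVar_var, if_neg (by omega), g4] at this
        simp [Expr.eval, this]
      · rw [State.setVar_setVar]
        refine ⟨?_, fun y => ?_, fun k hk => ?_⟩
        · have := g5.1
          simp only [State.setVar_arr] at this ⊢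
          rw [← this]
          exact k2.1
        · have := g5.2.1 y
          have h := k2.2.1 y
          rw [State.setVar_var] at this h ⊢
          rw [if_neg (by omega)] at h
          split_ifs at this ⊢
          · exact this
          · rw [← this, h]
        · have := g5.2.2 k hk
          have h := k2.2.2 k hk
          rw [State.setVar_var, if_neg (by omega)] at this h ⊢
          rw [h, this]
  · intro s' h
    simp [Expr.eval, h.2.2.2.1, h.2.1]
  · simpa using h₄
  · have := hX b
    simp only [Expr.cost]
    exact Nat.mul_le_mul (by omega) (by omega)
  · obtain ⟨g1, g2, g3, g4, g5⟩ := h₄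
    refine ⟨?_, ?_⟩
    · rw [State.setVar_var, if_neg (by omega), g1]; rfl
    · simp only [Expr.eval, g3]
      exact g5

theorem Tm.exists_correct (e : Tm) : ∃ f, PolyBdd f ∧ e.Correct f := by
  induction e with
  | lit c =>
    exact ⟨fun _ => 2, .const _, fun r X s σ hs hX => .assign
      ⟨by simp [Expr.eval, Tm.eval], (Frame.refl r s).setVar le_rfl _⟩⟩
  | var x =>
    exact ⟨fun _ => 2, .const _, fun r X s σ hs hX => .assign
      ⟨by simp [Expr.eval, Tm.eval, hs.1], (Frame.refl r s).setVar le_rfl _⟩⟩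
  | get a i ih =>
    obtain ⟨f, hf, h⟩ := ih
    refine ⟨fun X => f X + 3, hf.add (.const _), fun r X s σ hs hX =>
      .seq (h r X s σ hs hX) fun s₁ h₁ => .assign ⟨?_, h₁.2.setVar le_rfl _⟩⟩
    simp [Expr.eval, Tm.eval, h₁.1, h₁.2.1, hs.2]
  | add e f he hf =>
    obtain ⟨a, ha, ha'⟩ := he
    obtain ⟨b, hb, hb'⟩ := hf
    exact ⟨_, ha.add (hb.add (.const 4)), ha'.binary hb' .add (· + ·) (fun _ => rfl)
      (fun _ _ => rfl) (fun _ _ _ => rfl) fun _ => rfl⟩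
  | sub e f he hf =>
    obtain ⟨a, ha, ha'⟩ := he
    obtain ⟨b, hb, hb'⟩ := hf
    exact ⟨_, ha.add (hb.add (.const 4)), ha'.binary hb' .sub (· - ·) (fun _ => rfl)
      (fun _ _ => rfl) (fun _ _ _ => rfl) fun _ => rfl⟩
  | lt e f he hf =>
    obtain ⟨a, ha, ha'⟩ := he
    obtain ⟨b, hb, hb'⟩ := hf
    exact ⟨_, ha.add (hb.add (.const 4)), ha'.binary hb' .lt (fun x y => if x < y then 1 else 0)
      (fun _ => rfl) (fun _ _ => rfl) (fun _ _ _ => rfl) fun _ => rfl⟩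
  | eq e f he hf =>
    obtain ⟨a, ha, ha'⟩ := he
    obtain ⟨b, hb, hb'⟩ := hf
    exact ⟨_, ha.add (hb.add (.const 4)), ha'.binary hb' .eq (fun x y => if x = y then 1 else 0)
      (fun _ => rfl) (fun _ _ => rfl) (fun _ _ _ => rfl) fun _ => rfl⟩
  | mul e x ih =>
    obtain ⟨f, hf, h⟩ := ih
    exact ⟨_, hf.add ((PolyBdd.const 2).add ((PolyBdd.const 2).add
      (((PolyBdd.id.add (.const 1)).mul (.const 20)).add (.const 2)))), h.mul x⟩
  | ite c e f hc he hf =>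
    obtain ⟨a, ha, ha'⟩ := hc
    obtain ⟨b, hb, hb'⟩ := he
    obtain ⟨d, hd, hd'⟩ := hf
    refine ⟨_, ha.add ((PolyBdd.const 2).add (hb.add hd)), fun r X s σ hs hX =>
      .seq (ha' r X s σ hs hX) fun s₁ h₁ => .cond (fun h0 => ?_) fun h0 => ?_⟩
    · simp only [Expr.eval, h₁.1] at h0
      refine .mono (hb' r X s₁ σ (hs.frame h₁.2) hX) (by omega) fun s' h => ⟨?_, h₁.2.trans h.2 le_rfl⟩
      rw [h.1, Tm.eval, if_pos h0]
    · simp only [Expr.eval, h₁.1] at h0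
      refine .mono (hd' r X s₁ σ (hs.frame h₁.2) hX) (by omega) fun s' h => ⟨?_, h₁.2.trans h.2 le_rfl⟩
      rw [h.1, Tm.eval, if_neg (by simpa using h0)]
  | sum x b e ih =>
    obtain ⟨f, hf, h⟩ := ih
    exact ⟨_, (PolyBdd.const 2).add ((PolyBdd.const 2).add ((PolyBdd.const 2).add
      ((PolyBdd.const 2).add (((PolyBdd.id.add (.const 1)).mul (hf.add (.const 12))).add (.const 2))))),
      h.sum x b⟩

/-! ## Commands and their compilation -/

/-- Commands. `count x y b e` assigns to `x` the number of values of `y` below the variable `b` for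
which `e` does not vanish; `fill a e₀ x b e` overwrites row `e₀` of the array `a`, the length of a row
being the value of `b`, by the values of `e` for `x = 0, 1, ...`; `iter x b p` executes `p` for
`x = 0, 1, ...` below the initial value of `b`. -/
inductive Cmd where
  | count (x y b : ℕ) (e : Tm)
  | fill (a : ℕ) (e₀ : Tm) (x b : ℕ) (e : Tm)
  | seq (p q : Cmd)
  | iter (x b : ℕ) (p : Cmd)

/-- The effect of a `fill` command. -/
def State.fill (σ : State) (a row len : ℕ) (g : ℕ → ℕ) : State :=
  { σ with arr := Function.update σ.arr a fun j =>
      if row * len ≤ j ∧ j < row * len + len then g (j - row * len) else σ.arr a j }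

/-- The state after the execution of a command. -/
def Cmd.exec : Cmd → State → State
  | .count x y b e, σ => σ.setVar x ((Tm.sum y b (.ite e (.lit 1) (.lit 0))).eval σ)
  | .fill a e₀ x b e, σ => σ.fill a (e₀.eval σ) (σ.var b) fun i => e.eval (σ.setVar x i)
  | .seq p q, σ => q.exec (p.exec σ)
  | .iter x b p, σ => Nat.rec σ (fun i τ => p.exec (τ.setVar x i)) (σ.var b)

/-- The translation of commands to programs, which use the even variables from `2 * r` on. -/
def Cmd.compile : Cmd → ℕ → Prog
  | .count x y b e, r => .seq ((Tm.sum y b (.ite e (.lit 1) (.lit 0))).compile r)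
      (.assign (2 * x + 1) (.var (2 * r)))
  | .fill a e₀ x b e, r => .seq ((Tm.mul e₀ b).compile r)
      (.seq (.assign (2 * (r + 1)) (.var (2 * b + 1))) (.seq (.assign (2 * (r + 2)) (.var (2 * x + 1)))
      (.seq (.assign (2 * x + 1) (.lit 0))
      (.seq (.loop (.lt (.var (2 * x + 1)) (.var (2 * (r + 1)))) (.seq (e.compile (r + 3))
        (.seq (.store 1 (.var (2 * x + 1)) (.var (2 * (r + 3))))
          (.assign (2 * x + 1) (.add (.var (2 * x + 1)) (.lit 1))))))
      (.seq (.assign (2 * x + 1) (.lit 0))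
      (.seq (.loop (.lt (.var (2 * x + 1)) (.var (2 * (r + 1))))
        (.seq (.store (2 * a) (.add (.var (2 * r)) (.var (2 * x + 1))) (.get 1 (.var (2 * x + 1))))
          (.assign (2 * x + 1) (.add (.var (2 * x + 1)) (.lit 1)))))
      (.assign (2 * x + 1) (.var (2 * (r + 2))))))))))
  | .seq p q, r => .seq (p.compile r) (q.compile r)
  | .iter x b p, r => .seq (.assign (2 * r) (.var (2 * b + 1))) (.seq (.assign (2 * (r + 1)) (.lit 0))
      (.loop (.lt (.var (2 * (r + 1))) (.var (2 * r))) (.seq (.assign (2 * x + 1) (.var (2 * (r + 1))))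
        (.seq (p.compile (r + 2)) (.assign (2 * (r + 1)) (.add (.var (2 * (r + 1))) (.lit 1)))))))

theorem State.var_le_setVar {σ : State} {N : ℕ} (h : ∀ x, σ.var x ≤ N) {v : ℕ} (hv : v ≤ N) (x : ℕ) :
    ∀ y, (σ.setVar x v).var y ≤ N := by
  intro y
  rw [State.setVar_var]
  split_ifs
  exacts [hv, h y]

/-- A count is at most the bound of its range and an iteration index stays below its bound, so one
bound on the variables survives the whole execution. Large numbers arise only in arrays and in
intermediate values, which are never loop bounds. -/
theorem Cmd.exec_var_le (p : Cmd) {N : ℕ} {σ : State} (h : ∀ x, σ.var x ≤ N) (x : ℕ) :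
    (p.exec σ).var x ≤ N := by
  induction p generalizing σ x with
  | count z y b e =>
    refine σ.var_le_setVar h ((Finset.sum_le_card_nsmul _ _ 1 fun i _ => ?_).trans ?_) z x
    · simp only [Tm.eval]; split_ifs <;> simp
    · simpa using h b
  | fill a e₀ y b e => exact h x
  | seq p q hp hq => exact hq (hp h) x
  | iter y b p hp =>
    suffices H : ∀ k ≤ N, ∀ x, (Nat.rec σ (fun i τ => p.exec (τ.setVar y i)) k : State).var x ≤ N from
      H _ (h b) x
    intro k
    induction k with
    | zero => exact fun _ => h
    | succ k ih => exact fun hk x => hp (State.var_le_setVar (ih (by omega)) (by omega) y) x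

/-- The state of the machine variables in the loops of a compiled `fill` command. -/
def FillInv (s σ : State) (r x base len i : ℕ) (s' : State) : Prop :=
  s'.var (2 * r) = base ∧ s'.var (2 * (r + 1)) = len ∧ s'.var (2 * (r + 2)) = σ.var x ∧
  s'.var (2 * x + 1) = i ∧ (∀ y ≠ x, s'.var (2 * y + 1) = σ.var y) ∧ ∀ k < r, s'.var (2 * k) = s.var (2 * k)

theorem FillInv.setVar {s σ : State} {r x base len i : ℕ} {s' : State}
    (h : FillInv s σ r x base len i s') (j : ℕ) :
    FillInv s σ r x base len j (s'.setVar (2 * x + 1) j) := by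
  obtain ⟨h1, h2, h3, h4, h5, h6⟩ := h
  refine ⟨?_, ?_, ?_, ?_, fun y hy => ?_, fun k hk => ?_⟩ <;> rw [State.setVar_var]
  · rw [if_neg (by omega), h1]
  · rw [if_neg (by omega), h2]
  · rw [if_neg (by omega), h3]
  · simp
  · rw [if_neg (by omega), h5 y hy]
  · rw [if_neg (by omega), h6 k hk]

theorem FillInv.frame {s σ : State} {r x base len i : ℕ} {s' s'' : State}
    (h : FillInv s σ r x base len i s') (hf : Frame (r + 3) s' s'') :
    FillInv s σ r x base len i s'' := by
  obtain ⟨h1, h2, h3, h4, h5, h6⟩ := h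
  obtain ⟨-, k1, k2⟩ := hf
  exact ⟨by rw [k2 _ (by omega), h1], by rw [k2 _ (by omega), h2], by rw [k2 _ (by omega), h3],
    by rw [k1, h4], fun y hy => by rw [k1, h5 y hy], fun k hk => by rw [k2 _ (by omega), h6 k hk]⟩

theorem FillInv.rep {s σ : State} {r x base len i : ℕ} {s' : State}
    (h : FillInv s σ r x base len i s') (ha : ∀ a, s'.arr (2 * a) = σ.arr a) : Rep s' (σ.setVar x i) := by
  refine ⟨fun y => ?_, ha⟩
  rw [State.setVar_var]
  split_ifs with hy
  · rw [hy, h.2.2.2.1]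
  · exact h.2.2.2.2.1 y hy

/-- The compiled command has the effect of the command, in polynomial time. -/
def Cmd.Correct (p : Cmd) (f : ℕ → ℕ) : Prop :=
  ∀ (r X : ℕ) (s σ : State), Rep s σ → (∀ x, σ.var x + 2 ≤ X) →
    (p.compile r).Spec s (f X) fun s' => Rep s' (p.exec σ) ∧ ∀ k < r, s'.var (2 * k) = s.var (2 * k)

/-- The row is first computed into array `1`, which is odd and thus invisible to terms, and then
copied. Hence all entries are evaluated in the old contents, even if `e` reads `a`. -/
theorem Cmd.Correct.fill {a : ℕ} {e₀ : Tm} {x b : ℕ} {e : Tm} {f g : ℕ → ℕ}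
    (hf : (Tm.mul e₀ b).Correct f) (hg : e.Correct g) :
    (Cmd.fill a e₀ x b e).Correct fun X =>
      f X + (2 + (2 + (2 + ((X + 1) * (g X + 11) + (2 + ((X + 1) * 14 + 2)))))) := by
  intro r X s σ hs hX
  set base := e₀.eval σ * σ.var b with hbase
  set v : ℕ → ℕ := fun i => e.eval (σ.setVar x i) with hv
  have hdec : ∀ {s' : State}, (∀ y, s'.var (2 * y + 1) = σ.var y) → s'.var (2 * r) = base →
      s'.var (2 * (r + 1)) = σ.var b → s'.var (2 * (r + 2)) = σ.var x →
      (∀ k < r, s'.var (2 * k) = s.var (2 * k)) →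
      FillInv s σ r x base (σ.var b) (σ.var x) s' := fun h h1 h2 h3 h4 =>
    ⟨h1, h2, h3, h x, fun y _ => h y, h4⟩
  refine .seq (hf r X s σ hs hX) fun s₁ h₁ =>
    .seq (.assign (Q := fun s' => s'.var (2 * r) = base ∧ s'.var (2 * (r + 1)) = σ.var b ∧
      Frame r s s') ?_) fun s₂ h₂ =>
    .seq (.assign (Q := fun s' => FillInv s σ r x base (σ.var b) (σ.var x) s' ∧ s'.arr = s.arr) ?_)
      fun s₃ h₃ =>
    .seq (.assign (Q := fun s' => FillInv s σ r x base (σ.var b) 0 s' ∧ s'.arr = s.arr) ?_) fun s₄ h₄ =>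
    .seq (.mono (.loop (fun i s' => FillInv s σ r x base (σ.var b) i s' ∧
      (∀ c, s'.arr (2 * c) = σ.arr c) ∧ ∀ j < i, s'.arr 1 j = v j) (σ.var b) (g X + 7)
      ?_ ?_ ?_) ?_ fun _ h => h) fun s₅ h₅ =>
    .seq (.assign (Q := fun s' => FillInv s σ r x base (σ.var b) 0 s' ∧
      (∀ c, s'.arr (2 * c) = σ.arr c) ∧ ∀ j < σ.var b, s'.arr 1 j = v j) ?_) fun s₆ h₆ =>
    .seq (.mono (.loop (fun i s' => FillInv s σ r x base (σ.var b) i s' ∧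
      (∀ c, s'.arr (2 * c) = if c = a then (fun j => if base ≤ j ∧ j < base + i then v (j - base)
        else σ.arr a j) else σ.arr c) ∧ ∀ j < σ.var b, s'.arr 1 j = v j) (σ.var b) 10
      ?_ ?_ ?_) ?_ fun _ h => h) fun s₇ h₇ => .assign ?_
  · refine ⟨?_, ?_, h₁.2.setVar (by omega) _⟩
    · rw [State.setVar_var, if_neg (by omega), h₁.1]; rfl
    · simp [Expr.eval, (hs.frame h₁.2).1]
  · have hF := h₂.2.2.setVar (q := r + 2) (by omega) (Expr.eval s₂ (.var (2 * x + 1)))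
    refine ⟨hdec (hs.frame hF).1 ?_ ?_ ?_ hF.2.2, hF.1⟩
    · rw [State.setVar_var, if_neg (by omega), h₂.1]
    · rw [State.setVar_var, if_neg (by omega), h₂.2.1]
    · simp [Expr.eval, (hs.frame h₂.2.2).1]
  · exact ⟨h₃.1.setVar 0, h₃.2⟩
  · intro i hi s' ⟨h1, h2, h3⟩
    refine ⟨by simp [Expr.eval, h1.2.1, h1.2.2.2.1, hi], ?_⟩
    refine .mono (.seq (hg (r + 3) X s' _ (h1.rep h2) fun y => ?_) fun s₁ h₁ => .seq (B := 3) (C := 4)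
      (.store (Q := fun s' => FillInv s σ r x base (σ.var b) i s' ∧
      (∀ c, s'.arr (2 * c) = σ.arr c) ∧ ∀ j < i + 1, s'.arr 1 j = v j) ?_)
      fun s₂ h₂ => .assign ?_) (by omega) fun _ h => h
    · rw [State.setVar_var]
      split_ifs
      · have := hX b
        omega
      · exact hX y
    · refine ⟨(h1.frame h₁.2 : FillInv s σ r x base (σ.var b) i s₁), fun c => ?_, fun j hj => ?_⟩
      · rw [State.setArr_arr, if_neg (by omega), h₁.2.1, h2]
      · have hi' : s₁.var (2 * x + 1) = i := (h1.frame h₁.2).2.2.2.1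
        rw [State.setArr_arr, if_pos rfl, Function.update_apply]
        simp only [Expr.eval, hi', h₁.1]
        split_ifs with hji
        · rw [hji]
        · rw [h₁.2.1]; exact h3 j (by omega)
    · have := h₂.1.2.2.2.1
      simp only [Expr.eval, this]
      exact ⟨h₂.1.setVar _, h₂.2⟩
  · intro s' h
    simp [Expr.eval, h.1.2.1, h.1.2.2.2.1]
  · exact ⟨h₄.1, fun c => by rw [h₄.2]; exact hs.2 c, by simp⟩
  · have := hX b
    simp only [Expr.cost]
    exact Nat.mul_le_mul (by omega) (by omega)
  · exact ⟨h₅.1.setVar 0, h₅.2⟩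
  · intro i hi s' ⟨h1, h2, h3⟩
    refine ⟨by simp [Expr.eval, h1.2.1, h1.2.2.2.1, hi], ?_⟩
    refine .mono (.seq (B := 6) (C := 4) (.store (Q := fun s' => FillInv s σ r x base (σ.var b) i s' ∧
      (∀ c, s'.arr (2 * c) = if c = a then (fun j => if base ≤ j ∧ j < base + (i + 1) then v (j - base)
        else σ.arr a j) else σ.arr c) ∧ ∀ j < σ.var b, s'.arr 1 j = v j) ?_)
      fun s₂ h₂ => .assign ?_) (by omega) fun _ h => h
    · refine ⟨h1, fun c => ?_, fun j hj => ?_⟩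
      · rw [State.setArr_arr]
        simp only [Expr.eval, h1.1, h1.2.2.2.1, h3 i hi]
        by_cases hc : c = a
        · subst hc
          rw [if_pos rfl, if_pos rfl, h2 c, if_pos rfl]
          funext j
          rw [Function.update_apply]
          by_cases hj : j = base + i
          · subst hj
            rw [if_pos rfl, if_pos (by omega), Nat.add_sub_cancel_left]
          · rw [if_neg hj]
            exact if_congr (by omega) rfl rfl
        · rw [if_neg (by omega), h2 c]
          simp only [if_neg hc]
      · rw [State.setArr_arr, if_neg (by omega)]
        exact h3 j hj
    · have := h₂.1.2.2.2.1
      simp only [Expr.eval, this]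
      exact ⟨h₂.1.setVar _, h₂.2⟩
  · intro s' h
    simp [Expr.eval, h.1.2.1, h.1.2.2.2.1]
  · refine ⟨h₆.1, fun c => ?_, h₆.2.2⟩
    rw [h₆.2.1]
    split_ifs with hc
    · subst hc
      funext j
      rw [if_neg (by omega)]
    · rfl
  · have := hX b
    simp only [Expr.cost]
    exact Nat.mul_le_mul (by omega) (by omega)
  · simp only [Expr.eval, h₇.1.2.2.1]
    have h := h₇.1.setVar (σ.var x)
    refine ⟨⟨fun y => ?_, fun c => ?_⟩, h.2.2.2.2.2⟩
    · by_cases hy : y = x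
      · rw [hy, h.2.2.2.1]; rfl
      · exact h.2.2.2.2.1 y hy
    · simp only [State.setVar_arr, Cmd.exec, State.fill, Function.update_apply]
      exact h₇.2.1 c

/-- Bound and counter live in hidden registers and `x` is reloaded in each round, so `p` may
overwrite both `x` and `b`. -/
theorem Cmd.Correct.iter {p : Cmd} {f : ℕ → ℕ} (hp : p.Correct f) (x b : ℕ) :
    (Cmd.iter x b p).Correct fun X => 2 + (2 + (X + 1) * (f X + 10)) := by
  intro r X s σ hs hX
  let τ : ℕ → State := fun k => Nat.rec σ (fun i τ => p.exec (τ.setVar x i)) k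
  have hτ : ∀ k ≤ σ.var b, ∀ y, (τ k).var y + 2 ≤ X := by
    have hX' : ∀ y, σ.var y ≤ X - 2 := fun y => by have := hX y; omega
    have H : ∀ k ≤ σ.var b, ∀ y, (τ k).var y ≤ X - 2 := by
      intro k
      induction k with
      | zero => exact fun _ => hX'
      | succ k ih =>
        exact fun hk => p.exec_var_le (State.var_le_setVar (ih (by omega))
          (by have := hX' b; omega) x)
    intro k hk y
    have := H k hk y
    have := hX y
    omega
  refine .seq (.assign (Q := fun s' => s'.var (2 * r) = σ.var b ∧ Frame r s s') ?_) fun s₁ h₁ =>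
    .seq (.assign (Q := fun s' => s'.var (2 * r) = σ.var b ∧ s'.var (2 * (r + 1)) = 0 ∧
      Frame r s s') ?_) fun s₂ h₂ =>
    .mono (.loop (fun i s' => s'.var (2 * r) = σ.var b ∧ s'.var (2 * (r + 1)) = i ∧ Rep s' (τ i) ∧
      ∀ k < r, s'.var (2 * k) = s.var (2 * k)) (σ.var b) (f X + 6)
      ?_ ?_ ?_) ?_ fun _ h => h.2.2
  · exact ⟨by simp [Expr.eval, hs.1], (Frame.refl r s).setVar le_rfl _⟩
  · refine ⟨?_, by simp [Expr.eval], h₁.2.setVar (by omega) _⟩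
    rw [State.setVar_var, if_neg (by omega), h₁.1]
  · intro i hi s' ⟨h1, h2, h3, h4⟩
    refine ⟨by simp [Expr.eval, h1, h2, hi], ?_⟩
    refine .mono (.seq (B := 2) (C := f X + 4) (.assign (Q := fun s' => s'.var (2 * r) = σ.var b ∧
      s'.var (2 * (r + 1)) = i ∧ Rep s' ((τ i).setVar x i) ∧
      ∀ k < r, s'.var (2 * k) = s.var (2 * k)) ?_) fun s₁ h₁ => .seq (hp (r + 2) X s₁ _ h₁.2.2.1 ?_)
      fun s₂ h₂ => .assign ?_) (by omega) fun _ h => h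
    · refine ⟨?_, ?_, ⟨fun y => ?_, h3.2⟩, fun k hk => ?_⟩ <;> rw [State.setVar_var]
      · rw [if_neg (by omega), h1]
      · rw [if_neg (by omega), h2]
      · rw [State.setVar_var]
        simp only [Expr.eval, h2, h3.1 y]
        exact if_congr (by omega) rfl rfl
      · rw [if_neg (by omega), h4 k hk]
    · intro y
      rw [State.setVar_var]
      split_ifs
      · have := hX b
        omega
      · exact hτ i hi.le y
    · obtain ⟨k1, k2, k3, k4⟩ := h₁
      obtain ⟨l1, l2⟩ := h₂
      have e2 : s₂.var (2 * (r + 1)) = i := by rw [l2 _ (by omega), k2]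
      refine ⟨?_, ?_, ⟨fun y => ?_, l1.2⟩, fun k hk => ?_⟩
      · rw [State.setVar_var, if_neg (by omega), l2 _ (by omega), k1]
      · simp only [Expr.eval, e2, State.setVar_var, if_true]
      · rw [State.setVar_var, if_neg (by omega), l1.1]
      · rw [State.setVar_var, if_neg (by omega), l2 _ (by omega), k4 k hk]
  · intro s' h
    simp [Expr.eval, h.1, h.2.1]
  · exact ⟨h₂.1, h₂.2.1, hs.frame h₂.2.2, h₂.2.2.2.2⟩
  · have := hX b
    simp only [Expr.cost]
    exact Nat.mul_le_mul (by omega) (by omega)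

theorem Cmd.exists_correct (p : Cmd) : ∃ f, PolyBdd f ∧ p.Correct f := by
  induction p with
  | count x y b e =>
    obtain ⟨f, hf, h⟩ := (Tm.sum y b (.ite e (.lit 1) (.lit 0))).exists_correct
    refine ⟨fun X => f X + 2, hf.add (.const 2), fun r X s σ hs hX =>
      .seq (h r X s σ hs hX) fun s₁ h₁ => .assign ⟨⟨fun z => ?_, (hs.frame h₁.2).2⟩, fun k hk => ?_⟩⟩
    · simp only [Cmd.exec, Expr.eval, h₁.1, State.setVar_var, (hs.frame h₁.2).1]
      exact if_congr (by omega) rfl rfl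
    · rw [State.setVar_var, if_neg (by omega), h₁.2.2.2 k hk]
  | fill a e₀ x b e =>
    obtain ⟨f, hf, h⟩ := (Tm.mul e₀ b).exists_correct
    obtain ⟨g, hg, h'⟩ := e.exists_correct
    exact ⟨_, hf.add ((PolyBdd.const 2).add ((PolyBdd.const 2).add ((PolyBdd.const 2).add
      (((PolyBdd.id.add (.const 1)).mul (hg.add (.const 11))).add ((PolyBdd.const 2).add
      (((PolyBdd.id.add (.const 1)).mul (.const 14)).add (.const 2))))))), .fill h h'⟩
  | seq p q hp hq =>
    obtain ⟨f, hf, h⟩ := hp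
    obtain ⟨g, hg, h'⟩ := hq
    refine ⟨_, hf.add hg, fun r X s σ hs hX => .seq (h r X s σ hs hX) fun s₁ h₁ =>
      .mono (h' r X s₁ _ h₁.1 fun x => ?_) le_rfl fun s₂ h₂ =>
        ⟨h₂.1, fun k hk => (h₂.2 k hk).trans (h₁.2 k hk)⟩⟩
    have h0 : ∀ y, σ.var y ≤ X - 2 := fun y => by have := hX y; omega
    have := p.exec_var_le h0 x
    have := hX 0
    omega
  | iter x b p hp =>
    obtain ⟨f, hf, h⟩ := hp
    exact ⟨_, (PolyBdd.const 2).add ((PolyBdd.const 2).add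
      ((PolyBdd.id.add (.const 1)).mul (hf.add (.const 10)))), h.iter x b⟩

/-! ## Distances in forests -/

section Forest

variable {V : Type*} {G : SimpleGraph V}

theorem dist_add_dist_le_length {x y v : V} (p : G.Walk x y) (hv : v ∈ p.support) :
    G.dist x v + G.dist v y ≤ p.length := by
  classical
  have h := congrArg SimpleGraph.Walk.length (p.take_spec hv)
  rw [SimpleGraph.Walk.length_append] at h
  have h1 := SimpleGraph.dist_le (p.takeUntil v hv)
  have h2 := SimpleGraph.dist_le (p.dropUntil v hv)
  omega

theorem eq_of_isPath (hG : G.IsAcyclic) {x y : V} {p q : G.Walk x y} (hp : p.IsPath) (hq : q.IsPath) :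
    p = q := by
  have := hG.subsingleton_path x y
  exact congrArg Subtype.val (Subsingleton.elim (⟨p, hp⟩ : G.Path x y) ⟨q, hq⟩)

theorem length_eq_dist_of_isPath (hG : G.IsAcyclic) {x y : V} {p : G.Walk x y} (hp : p.IsPath) :
    p.length = G.dist x y := by
  obtain ⟨q, hq, hl⟩ := p.reachable.exists_path_of_dist
  rw [← hl, eq_of_isPath hG hp hq]

/-- Paths in a forest are unique and therefore geodesic. If the distances add up, two geodesics
through `v` concatenate to a shortest walk, which must be `p`. -/
theorem mem_support_iff_dist (hG : G.IsAcyclic) {x y v : V} {p : G.Walk x y} (hp : p.IsPath)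
    (hv : G.Reachable v x) : v ∈ p.support ↔ G.dist v x + G.dist v y = G.dist x y := by
  have hl := length_eq_dist_of_isPath hG hp
  constructor
  · intro h
    have h1 := dist_add_dist_le_length p h
    have h2 := hv.symm.dist_triangle_left y
    rw [SimpleGraph.dist_comm (u := v) (v := x)]
    omega
  · intro h
    obtain ⟨q, hq⟩ := hv.symm.exists_walk_length_eq_dist
    obtain ⟨q', hq'⟩ := (hv.trans p.reachable).exists_walk_length_eq_dist
    have hql : (q.append q').length = G.dist x y := by
      rw [SimpleGraph.Walk.length_append, hq, hq', ← h, SimpleGraph.dist_comm]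
    rw [eq_of_isPath hG hp ((q.append q').isPath_of_length_eq_dist hql)]
    simp

/-- If `u` is the next vertex on the way from `v` to `x` but not on the way from `v` to `y`, then `v`
lies between `x` and `y`. -/
theorem dist_add_dist_of_adj (hG : G.IsAcyclic) {u v x y : V} (huv : G.Adj u v) (hx : G.Reachable v x)
    (hy : G.Reachable v y) (h1 : G.dist u x + 1 = G.dist v x) (h2 : G.dist v y + 1 = G.dist u y) :
    G.dist v x + G.dist v y = G.dist x y := by
  obtain ⟨p, hp⟩ := (hx.symm.trans hy).exists_walk_length_eq_dist
  obtain ⟨q, hq⟩ := (huv.reachable.trans hx).exists_walk_length_eq_dist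
  obtain ⟨q', hq'⟩ := hy.symm.exists_walk_length_eq_dist
  have hq1 : s(u, v) ∉ q.edges := fun h => by
    have := dist_add_dist_le_length q (q.snd_mem_support_of_mem_edges h)
    omega
  have hq2 : s(u, v) ∉ q'.edges := fun h => by
    have := dist_add_dist_le_length q' (q'.fst_mem_support_of_mem_edges h)
    rw [SimpleGraph.dist_comm (u := y) (v := u)] at this
    rw [SimpleGraph.dist_comm (u := y) (v := v)] at hq'
    omega
  -- The edge `uv` is a bridge, so the walk from `u` via `x` and `y` to `v` crosses it. The
  -- geodesics `q` and `q'` do not, so the part from `x` to `y` passes through `v`.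
  have hb := SimpleGraph.isBridge_iff_forall_walk_mem_edges.1
    (SimpleGraph.isAcyclic_iff_forall_adj_isBridge.1 hG huv) (q.append (p.append q'))
  rw [SimpleGraph.Walk.edges_append, SimpleGraph.Walk.edges_append, List.mem_append,
    List.mem_append] at hb
  have hvp := p.snd_mem_support_of_mem_edges ((hb.resolve_left hq1).resolve_right hq2)
  have h3 := dist_add_dist_le_length p hvp
  have h4 := hx.symm.dist_triangle_left y
  rw [SimpleGraph.dist_comm (u := v) (v := x)]
  omega

theorem dist_succ_or_succ (hG : G.IsAcyclic) {u v x : V} (huv : G.Adj u v) (hx : G.Reachable v x) :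
    G.dist u x + 1 = G.dist v x ∨ G.dist v x + 1 = G.dist u x := by
  have := hG.dist_eq_dist_add_one_of_adj_of_reachable x huv (hx.symm.trans huv.symm.reachable)
  rw [SimpleGraph.dist_comm (u := u), SimpleGraph.dist_comm (u := v)]
  omega

theorem exists_adj_dist_succ {v x : V} (hx : G.Reachable v x) (hne : v ≠ x) :
    ∃ u, G.Adj u v ∧ G.dist u x + 1 = G.dist v x := by
  obtain ⟨p, hp⟩ := hx.exists_walk_length_eq_dist
  cases p with
  | nil => exact absurd rfl hne
  | cons h q =>
    refine ⟨_, h.symm, ?_⟩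
    have h1 := SimpleGraph.dist_le q
    have h2 := h.reachable.dist_triangle_left x
    rw [SimpleGraph.dist_eq_one_iff_adj.2 h] at h2
    rw [SimpleGraph.Walk.length_cons] at hp
    omega

/-- A vertex is within distance `ℓ` of the path from `x` to `y` if its distances to `x` and `y` add up
to at most `dist x y + 2 * ℓ`. -/
theorem exists_mem_support_edist_le (hG : G.IsAcyclic) {x y : V} {p : G.Walk x y} (hp : p.IsPath) (ℓ : ℕ)
    {v : V} (hv : G.Reachable v x) (h : G.dist v x + G.dist v y ≤ G.dist x y + 2 * ℓ) :
    ∃ u ∈ p.support, G.edist u v ≤ (ℓ : ℕ∞) := by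
  induction hd : G.dist v x generalizing v ℓ with
  | zero =>
    have : v = x := hv.dist_eq_zero_iff.1 hd
    exact ⟨x, p.start_mem_support, by simp [this]⟩
  | succ d ih =>
    by_cases hvp : v ∈ p.support
    · exact ⟨v, hvp, by simp⟩
    have hne := mt (mem_support_iff_dist hG hp hv).2 hvp
    have htri := hv.symm.dist_triangle_left y
    rw [SimpleGraph.dist_comm (u := x) (v := v)] at htri
    obtain ⟨u, huv, hu⟩ := exists_adj_dist_succ hv (fun h => by simp [h] at hd)
    have hy := hv.trans p.reachable
    rcases dist_succ_or_succ hG huv hy with h1 | h1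
    -- Off the path the excess is positive, so `ℓ ≥ 1`. Moving to `u` lowers both distances by one,
    -- which is paid for by lowering `ℓ` by one.
    · obtain ⟨ℓ, rfl⟩ : ∃ k, ℓ = k + 1 := ⟨ℓ - 1, by omega⟩
      obtain ⟨z, hz, hzu⟩ := ih ℓ (huv.reachable.trans hv) (by omega) (by omega)
      refine ⟨z, hz, (SimpleGraph.edist_triangle (v := u)).trans ?_⟩
      push_cast
      exact add_le_add hzu (SimpleGraph.edist_eq_one_iff_adj.2 huv).le
    · exact absurd (dist_add_dist_of_adj hG huv hv hy hu h1) hne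

theorem dist_add_dist_le_of_edist_le (hG : G.IsAcyclic) {x y : V} {p : G.Walk x y} (hp : p.IsPath)
    {ℓ : ℕ} {u v : V} (hu : u ∈ p.support) (h : G.edist u v ≤ (ℓ : ℕ∞)) :
    G.Reachable v x ∧ G.dist v x + G.dist v y ≤ G.dist x y + 2 * ℓ := by
  have huv : G.Reachable u v := SimpleGraph.edist_ne_top_iff_reachable.1 fun h' => by simp [h'] at h
  classical
  have hux : G.Reachable u x := (p.takeUntil u hu).reachable.symm
  rw [← huv.coe_dist_eq_edist, Nat.cast_le] at h
  have h1 := (mem_support_iff_dist hG hp hux).1 hu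
  have h2 := huv.symm.dist_triangle_left x
  have h3 := huv.symm.dist_triangle_left y
  rw [SimpleGraph.dist_comm (u := v) (v := u)] at h2 h3
  exact ⟨huv.symm.trans hux, by omega⟩

/-- Prepending `u` to geodesics from `w` and `w'` gives two paths from `u` to `r`; by uniqueness
they share their second vertex. -/
theorem eq_of_dist_succ (hG : G.IsAcyclic) {r u w w' : V} (hw : G.Adj u w) (hw' : G.Adj u w')
    (hr : G.Reachable u r) (h : G.dist w r + 1 = G.dist u r) (h' : G.dist w' r + 1 = G.dist u r) :
    w = w' := by
  obtain ⟨p, hp⟩ := (hw.symm.reachable.trans hr).exists_walk_length_eq_dist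
  obtain ⟨q, hq⟩ := (hw'.symm.reachable.trans hr).exists_walk_length_eq_dist
  have hp' := (SimpleGraph.Walk.cons hw p).isPath_of_length_eq_dist (by simp [hp, h])
  have hq' := (SimpleGraph.Walk.cons hw' q).isPath_of_length_eq_dist (by simp [hq, h'])
  simpa using congrArg SimpleGraph.Walk.snd (eq_of_isPath hG hp' hq')

/-- Every nonempty finite set of vertices of a forest contains a vertex with at most one neighbor in
the set. -/
theorem exists_subsingleton_neighbors (hG : G.IsAcyclic) {R : Finset V} (hR : R.Nonempty) :
    ∃ u ∈ R, ∀ w ∈ R, ∀ w' ∈ R, G.Adj u w → G.Adj u w' → w = w' := by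
  classical
  obtain ⟨r, hr⟩ := hR
  let H := G.induce (R : Set V)
  have hH : H.IsAcyclic := hG.induce _
  let r' : (R : Set V) := ⟨r, hr⟩
  have : Fintype (R : Set V) := inferInstanceAs (Fintype R)
  -- A vertex farthest from `r` in its component of the induced forest: all its neighbors are closer
  -- to `r`, and there is only one such neighbor.
  obtain ⟨u, hu, hmax⟩ := Finset.exists_max_image
    (Finset.univ.filter fun u => H.Reachable u r') (fun u => H.dist u r') ⟨r', by simp⟩
  rw [Finset.mem_filter] at hu
  have key : ∀ w, H.Adj u w → H.dist w r' + 1 = H.dist u r' := fun w hw =>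
    (dist_succ_or_succ hH hw.symm hu.2).resolve_right fun h => by
      have := hmax w (by simpa using hw.symm.reachable.trans hu.2)
      omega
  refine ⟨u, u.2, fun w hw w' hw' h h' => ?_⟩
  have a : H.Adj u ⟨w, hw⟩ := h
  have a' : H.Adj u ⟨w', hw'⟩ := h'
  exact congrArg Subtype.val (eq_of_dist_succ hH a a' hu.2 (key _ a) (key _ a'))

end Forest

/-! ## Sums of weights -/

/-- At least `t` powers of two are needed to represent a number that is `-1` modulo `2 ^ t`, and with
exactly `t` of them the powers are `1, 2, ..., 2 ^ (t - 1)`. -/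
theorem le_sum_of_dvd_sum_pow (t : ℕ) (c : ℕ → ℕ) (h : 2 ^ t ∣ ∑ i ∈ Finset.range t, c i * 2 ^ i + 1) :
    t ≤ ∑ i ∈ Finset.range t, c i ∧ (∑ i ∈ Finset.range t, c i = t → ∀ i < t, c i = 1) := by
  induction t generalizing c with
  | zero => simp
  | succ t ih =>
    rw [Finset.sum_range_succ'] at h ⊢
    have hs : ∑ i ∈ Finset.range t, c (i + 1) * 2 ^ (i + 1) =
        2 * ∑ i ∈ Finset.range t, c (i + 1) * 2 ^ i := by
      rw [Finset.mul_sum]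
      exact Finset.sum_congr rfl fun i _ => by ring
    rw [hs, pow_succ', pow_zero, mul_one] at h
    obtain ⟨q, hq⟩ : ∃ q, c 0 = 2 * q + 1 := by
      have : 2 ∣ 2 * ∑ i ∈ Finset.range t, c (i + 1) * 2 ^ i + c 0 + 1 := (Dvd.intro _ rfl).trans h
      exact ⟨c 0 / 2, by omega⟩
    cases t with
    | zero => exact ⟨by simp; omega, fun h i hi => by simp at h; rw [show i = 0 by omega, h]⟩
    | succ t =>
      -- Binary carry: of the `2 * q + 1` ones, `q` pairs become twos, and everything is halved. The
      -- number of summands drops by `q + 1`, so equality forces `q = 0`.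
      let c' : ℕ → ℕ := fun i => if i = 0 then c 1 + q else c (i + 1)
      have e1 : ∑ i ∈ Finset.range (t + 1), c' i = ∑ i ∈ Finset.range (t + 1), c (i + 1) + q := by
        rw [Finset.sum_range_succ', Finset.sum_range_succ']
        simp [c']
        ring
      have e2 : ∑ i ∈ Finset.range (t + 1), c' i * 2 ^ i =
          ∑ i ∈ Finset.range (t + 1), c (i + 1) * 2 ^ i + q := by
        rw [Finset.sum_range_succ', Finset.sum_range_succ']
        simp [c']
        ring
      obtain ⟨h1, h2⟩ := ih c' (by
        rw [e2]
        refine Nat.dvd_of_mul_dvd_mul_left (k := 2) (by norm_num) ?_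
        convert h using 1
        rw [hq]
        ring)
      rw [e1] at h1 h2
      refine ⟨by omega, fun h i hi => ?_⟩
      have h3 := h2 (by omega)
      rcases i with _ | _ | i
      · omega
      · have := h3 0 (by omega)
        simp only [c', if_true] at this
        simpa using (by omega : c 1 = 1)
      · simpa [c'] using h3 (i + 1) (by omega)

/-- The weight of a path of the family `i`. -/
def weight (t i : ℕ) : ℕ := 2 ^ i + 2 ^ t

/-- The total weight of one path from each family. -/
def target (t : ℕ) : ℕ := 2 ^ t - 1 + 2 ^ t * t

theorem sum_weight (t : ℕ) : ∑ i ∈ Finset.range t, weight t i = target t := by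
  have := Nat.geomSum_eq (m := 2) le_rfl t
  simp only [weight, Finset.sum_add_distrib, this, target]
  simp [mul_comm]

/-- Modulo `2^t` the low parts sum to `-1`, which needs at least `t` summands; the part `2^t` of
each weight rules out more than `t`. -/
theorem eq_one_of_sum_weight {t : ℕ} {c : ℕ → ℕ}
    (h : ∑ i ∈ Finset.range t, c i * weight t i = target t) : ∀ i < t, c i = 1 := by
  have e : ∑ i ∈ Finset.range t, c i * weight t i =
      ∑ i ∈ Finset.range t, c i * 2 ^ i + 2 ^ t * ∑ i ∈ Finset.range t, c i := by
    rw [Finset.mul_sum, ← Finset.sum_add_distrib]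
    exact Finset.sum_congr rfl fun i _ => by rw [weight]; ring
  have hp : 0 < 2 ^ t := by positivity
  rw [e, target] at h
  set s := ∑ i ∈ Finset.range t, c i
  have hd : 2 ^ t ∣ ∑ i ∈ Finset.range t, c i * 2 ^ i + 1 := by
    have h' : ∑ i ∈ Finset.range t, c i * 2 ^ i + 1 + 2 ^ t * s = 2 ^ t * (t + 1) := by
      rw [mul_add]; omega
    exact (Nat.dvd_add_left (Dvd.intro _ rfl)).1 (h' ▸ Dvd.intro _ rfl)
  obtain ⟨h1, h2⟩ := le_sum_of_dvd_sum_pow t c hd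
  refine h2 (le_antisymm ?_ h1)
  by_contra hlt
  have : 2 ^ t * (t + 1) ≤ 2 ^ t * s := Nat.mul_le_mul_left _ (by omega)
  rw [mul_add] at this
  omega

/-! ## Elimination of a vertex -/

/-- A choice of a label and a weight for every vertex in `R`, subject to the constraints `M` for
single vertices and `C` for pairs of vertices, with total weight `w`. -/
def Solvable {ι L : Type*} (C : ι → ι → L → L → Prop) (R : Finset ι) (M : ι → L → ℕ → Prop) (w : ℕ) :
    Prop :=
  ∃ (g : ι → L) (f : ι → ℕ), (∀ v ∈ R, M v (g v) (f v)) ∧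
    (∀ v ∈ R, ∀ u ∈ R, v ≠ u → C v u (g v) (g u)) ∧ ∑ v ∈ R, f v = w

/-- The constraints that remain for `v` when `u` is eliminated. -/
def merge {ι L : Type*} [DecidableEq ι] (C : ι → ι → L → L → Prop) (M : ι → L → ℕ → Prop) (u v : ι) :
    ι → L → ℕ → Prop := fun z l w =>
  if z = v then ∃ w₁ w₂ l', w = w₁ + w₂ ∧ M v l w₁ ∧ M u l' w₂ ∧ C v u l l' else M z l w

/-- Since `u` interacts with `v` only, its label and weight can be chosen after those of `v`. The
weight of `u` is booked on `v`; undoing the merge splits it again. -/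
theorem solvable_erase_iff {ι L : Type*} [DecidableEq ι] {C : ι → ι → L → L → Prop}
    (hC : ∀ u v l l', C u v l l' → C v u l' l) {R : Finset ι} {M : ι → L → ℕ → Prop} {u v : ι}
    (hu : u ∈ R) (hv : v ∈ R) (huv : u ≠ v)
    (hfree : ∀ z ∈ R, z ≠ u → z ≠ v → ∀ l l', C z u l l') (w : ℕ) :
    Solvable C (R.erase u) (merge C M u v) w ↔ Solvable C R M w := by
  have hvu : v ∈ R.erase u := Finset.mem_erase.2 ⟨huv.symm, hv⟩
  constructor
  · rintro ⟨g, f, hM, hc, hw⟩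
    have h1 := hM v hvu
    simp only [merge, if_true] at h1
    obtain ⟨w₁, w₂, l', hw12, hv1, hu1, hC1⟩ := h1
    have hsum : ∑ z ∈ (R.erase u).erase v, Function.update (Function.update f v w₁) u w₂ z =
        ∑ z ∈ (R.erase u).erase v, f z := Finset.sum_congr rfl fun z hz => by
      simp only [Finset.mem_erase] at hz
      rw [Function.update_of_ne hz.2.1, Function.update_of_ne hz.1]
    refine ⟨Function.update g u l', Function.update (Function.update f v w₁) u w₂, fun z hz => ?_,
      fun z hz z' hz' hzz => ?_, ?_⟩
    · by_cases h : z = u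
      · subst h; simpa using hu1
      by_cases h' : z = v
      · subst h'; simpa [h] using hv1
      · have := hM z (Finset.mem_erase.2 ⟨h, hz⟩)
        simp only [merge, if_neg h'] at this
        simpa [h, h'] using this
    · have key : ∀ z ∈ R, z ≠ u → C z u (g z) l' := fun z hz h => by
        by_cases h' : z = v
        · subst h'; exact hC1
        · exact hfree z hz h h' _ _
      by_cases h : z = u
      · subst h
        simpa [hzz.symm] using hC _ _ _ _ (key z' hz' hzz.symm)
      · by_cases h' : z' = u
        · subst h'
          simpa [h] using key z hz h
        · simpa [h, h'] using hc z (Finset.mem_erase.2 ⟨h, hz⟩) z' (Finset.mem_erase.2 ⟨h', hz'⟩) hzz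
    · rw [← Finset.add_sum_erase _ _ hu, ← Finset.add_sum_erase _ _ hvu, hsum, ← hw,
        ← Finset.add_sum_erase _ f hvu]
      simp [huv.symm, hw12]
      ring
  · rintro ⟨g, f, hM, hc, hw⟩
    refine ⟨g, Function.update f v (f v + f u), fun z hz => ?_, fun z hz z' hz' hzz =>
      hc z (Finset.mem_of_mem_erase hz) z' (Finset.mem_of_mem_erase hz') hzz, ?_⟩
    · by_cases h' : z = v
      · subst h'
        simp only [merge, if_true, Function.update_self]
        exact ⟨_, _, _, rfl, hM z hv, hM u hu, hc z hv u hu huv.symm⟩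
      · simp only [merge, if_neg h', Function.update_of_ne h']
        exact hM z (Finset.mem_of_mem_erase hz)
    · have hsum : ∑ z ∈ (R.erase u).erase v, Function.update f v (f v + f u) z =
          ∑ z ∈ (R.erase u).erase v, f z := Finset.sum_congr rfl fun z hz => by
        rw [Function.update_of_ne (Finset.ne_of_mem_erase hz)]
      rw [← Finset.add_sum_erase _ _ hvu, hsum, ← hw, ← Finset.add_sum_erase _ f hu,
        ← Finset.add_sum_erase _ f hvu]
      simp
      ring

/-! ## Colorful Path-Cover as a labeling problem -/

namespace Instance

variable (I : Instance)

/-- The distance of two vertices, and `n` if they lie in different trees. -/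
noncomputable def D (u v : ℕ) : ℕ :=
  open Classical in
  if h : ∃ (hu : u < I.n) (hv : v < I.n), I.F.Reachable ⟨u, hu⟩ ⟨v, hv⟩ then
    I.F.dist ⟨u, h.1⟩ ⟨v, h.2.1⟩ else I.n

/-- Adjacency of vertices given by their numbers. -/
def Adj (u v : ℕ) : Prop := ∃ (hu : u < I.n) (hv : v < I.n), I.F.Adj ⟨u, hu⟩ ⟨v, hv⟩

/-- Membership in `B` of a vertex given by its number. -/
def MemB (v : ℕ) : Prop := ∃ hv : v < I.n, (⟨v, hv⟩ : Fin I.n) ∈ I.B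

/-- The path between the vertices with the numbers `x` and `y` belongs to the family `i`. -/
def Fam (i x y : ℕ) : Prop := ∃ (hi : i < I.t) (hx : x < I.n) (hy : y < I.n),
  ∃ p : I.F.Walk ⟨x, hx⟩ ⟨y, hy⟩, p.IsPath ∧ p.toSubgraph ∈ I.family ⟨i, hi⟩

/-- The constraints for the label `l` and the weight `w` of the vertex `v`. A label is a pair of end
vertices of a path, or `n` and any number. The number `n` stands for an additional vertex. -/
def Base (v : ℕ) (l : ℕ × ℕ) (w : ℕ) : Prop :=
  l.1 ≤ I.n ∧ l.2 ≤ I.n ∧ if v = I.n then w = 0 else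
    (l.1 = I.n ∧ ¬ I.MemB v ∧ w = 0) ∨ (l.1 < I.n ∧ l.2 < I.n ∧ I.D v l.1 < I.n ∧
      ∃ i < I.t, I.Fam i l.1 l.2 ∧ (I.MemB v → I.D v l.1 + I.D v l.2 ≤ I.D l.1 l.2 + (I.ℓ + I.ℓ)) ∧
        w = if l.1 = v then weight I.t i else 0)

/-- The constraints for the labels of adjacent vertices: the next vertex on the way to the first end
vertex of the label has the same label. -/
def Compat (v u : ℕ) (l l' : ℕ × ℕ) : Prop := I.Adj v u →
  (l.1 < I.n → I.D u l.1 + 1 = I.D v l.1 → l' = l) ∧ (l'.1 < I.n → I.D v l'.1 + 1 = I.D u l'.1 → l' = l)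

variable {I}

theorem D_of_reachable {u v : Fin I.n} (h : I.F.Reachable u v) : I.D u v = I.F.dist u v := by
  rw [D, dif_pos ⟨u.2, v.2, h⟩]

theorem D_of_not_reachable {u v : Fin I.n} (h : ¬ I.F.Reachable u v) : I.D u v = I.n :=
  dif_neg fun ⟨_, _, h'⟩ => h h'

theorem dist_lt (u v : Fin I.n) : I.F.dist u v < I.n := by
  by_cases h : I.F.Reachable u v
  · obtain ⟨p, hp, hl⟩ := h.exists_path_of_dist
    simpa [hl] using hp.length_lt
  · rw [SimpleGraph.dist_eq_zero_of_not_reachable h]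
    exact u.pos

theorem D_lt_iff {u v : Fin I.n} : I.D u v < I.n ↔ I.F.Reachable u v := by
  by_cases h : I.F.Reachable u v
  · simp [D_of_reachable h, h, dist_lt]
  · simp [D_of_not_reachable h, h]

theorem Adj.symm {u v : ℕ} (h : I.Adj u v) : I.Adj v u := ⟨h.2.1, h.1, h.2.2.symm⟩

theorem Compat.symm {u v : ℕ} {l l' : ℕ × ℕ} (h : I.Compat u v l l') : I.Compat v u l' l :=
  fun ha => ⟨fun h1 h2 => ((h ha.symm).2 h1 h2).symm, fun h1 h2 => ((h ha.symm).1 h1 h2).symm⟩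

theorem eq_of_mem_verts {i j : Fin I.t} {P Q : I.F.Subgraph} (hP : P ∈ I.family i)
    (hQ : Q ∈ I.family j) {v : Fin I.n} (hv : v ∈ P.verts) (hv' : v ∈ Q.verts) : i = j := by
  by_contra h
  exact Set.disjoint_left.1 (I.family_disjoint i j h P hP Q hQ) hv hv'

theorem eq_of_mem_family {i j : Fin I.t} {P : I.F.Subgraph} (hP : P ∈ I.family i)
    (hP' : P ∈ I.family j) : i = j := by
  obtain ⟨u, v, p, -, rfl⟩ := I.family_path i P hP
  have hu : u ∈ p.toSubgraph.verts := by simp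
  exact eq_of_mem_verts hP hP' hu hu

/-- Each step from `v` towards `x` preserves the label by `Compat`, so the label arrives at `x`. -/
theorem label_start_eq {g : ℕ → ℕ × ℕ}
    (hc : ∀ v u : Fin I.n, I.F.Adj v u → I.Compat v u (g v) (g u)) {x : Fin I.n} (d : ℕ) {v : Fin I.n}
    (hv : I.F.Reachable v x) (hd : I.F.dist v x = d) (hg : (g v).1 = x) : g x = g v := by
  induction d generalizing v with
  | zero => rw [hv.dist_eq_zero_iff.1 hd]
  | succ d ih =>
    obtain ⟨u, huv, hu⟩ := exists_adj_dist_succ hv (fun h => by simp [h] at hd)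
    have hux := huv.reachable.trans hv
    have := (hc v u huv.symm ⟨v.2, u.2, huv.symm⟩).1 (by rw [hg]; exact x.2)
      (by rw [hg, D_of_reachable hux, D_of_reachable hv, hu])
    rw [ih hux (by omega) (by rw [this, hg]), this]

/-- The selected paths are read off at the vertices that are the first end of their own label; all
other vertices have weight `0`. The total weight forces exactly one such vertex for each family. -/
theorem isYes_of_solvable (h : Solvable I.Compat (Finset.range (I.n + 1)) I.Base (target I.t)) :
    I.IsYes := by
  classical
  obtain ⟨g, f, hB, hC, hw⟩ := h
  have hbase : ∀ v < I.n, ((g v).1 = I.n ∧ ¬ I.MemB v ∧ f v = 0) ∨ ((g v).1 < I.n ∧ (g v).2 < I.n ∧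
      I.D v (g v).1 < I.n ∧ ∃ i < I.t, I.Fam i (g v).1 (g v).2 ∧
        (I.MemB v → I.D v (g v).1 + I.D v (g v).2 ≤ I.D (g v).1 (g v).2 + (I.ℓ + I.ℓ)) ∧
        f v = if (g v).1 = v then weight I.t i else 0) := fun v hv => by
    have := (hB v (by simp; omega)).2.2
    rwa [if_neg hv.ne] at this
  have hc : ∀ v u : Fin I.n, I.F.Adj v u → I.Compat v u (g v) (g u) := fun v u h =>
    hC v (by simp) u (by simp) fun h' => h.ne (Fin.ext h')
  have hfn : f I.n = 0 := by simpa using (hB I.n (by simp)).2.2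
  have hstart : ∀ v, ∃ i, v < I.n → (g v).1 = v → i < I.t ∧ I.Fam i (g v).1 (g v).2 ∧
      f v = weight I.t i := fun v => by
    by_cases h : v < I.n ∧ (g v).1 = v
    · rcases hbase v h.1 with h1 | ⟨-, -, -, i, hi, hf, -, hw⟩
      · omega
      · exact ⟨i, fun _ _ => ⟨hi, hf, by rw [hw, if_pos h.2]⟩⟩
    -- A default index for vertices at which no path starts.
    · exact ⟨0, fun h1 h2 => absurd ⟨h1, h2⟩ h⟩
  choose fi hfi using hstart
  let T := (Finset.range I.n).filter fun v => (g v).1 = v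
  have hT : ∀ {v}, v ∈ T ↔ v < I.n ∧ (g v).1 = v := fun {v} => by simp [T]
  have hsum : ∑ i ∈ Finset.range I.t, (T.filter fun v => fi v = i).card * weight I.t i = target I.t := by
    rw [← hw, Finset.sum_range_succ, hfn, add_zero, ← Finset.sum_filter_add_sum_filter_not
      (Finset.range I.n) (fun v => (g v).1 = v)]
    rw [Finset.sum_eq_zero (s := (Finset.range I.n).filter fun v => ¬ (g v).1 = v), add_zero]
    · rw [← Finset.sum_fiberwise_of_maps_to (s := T) (t := Finset.range I.t) (g := fi)
        (fun v hv => Finset.mem_range.2 (hfi v (hT.1 hv).1 (hT.1 hv).2).1)]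
      refine Finset.sum_congr rfl fun i _ => ?_
      rw [Finset.card_eq_sum_ones, Finset.sum_mul]
      refine Finset.sum_congr rfl fun v hv => ?_
      obtain ⟨hvT, rfl⟩ := Finset.mem_filter.1 hv
      rw [one_mul, (hfi v (hT.1 hvT).1 (hT.1 hvT).2).2.2]
    · intro v hv
      obtain ⟨hv, hg⟩ := Finset.mem_filter.1 hv
      rcases hbase v (by simpa using hv) with h1 | ⟨-, -, -, i, -, -, -, hw⟩
      · exact h1.2.2
      · rw [hw, if_neg hg]
  have hone := eq_one_of_sum_weight hsum
  have hex : ∀ i : Fin I.t, ∃ v, (v < I.n ∧ (g v).1 = v ∧ fi v = i) ∧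
      ∀ v', v' < I.n → (g v').1 = v' → fi v' = i → v' = v := fun i => by
    obtain ⟨v, hv⟩ := Finset.card_eq_one.1 (hone i i.2)
    have hv' : ∀ z, z ∈ T.filter (fun v => fi v = i) ↔ z = v := fun z => by rw [hv]; simp
    simp only [Finset.mem_filter, hT] at hv'
    have := (hv' v).2 rfl
    exact ⟨v, ⟨this.1.1, this.1.2, this.2⟩, fun v' h1 h2 h3 => (hv' v').1 ⟨⟨h1, h2⟩, h3⟩⟩
  choose st hst hst' using hex
  have hpath : ∀ i : Fin I.t, ∃ P ∈ I.family i, ∃ (hx : (g (st i)).1 < I.n) (hy : (g (st i)).2 < I.n)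
      (p : I.F.Walk ⟨_, hx⟩ ⟨_, hy⟩), p.IsPath ∧ P = p.toSubgraph := fun i => by
    obtain ⟨-, ⟨hi, hx, hy, p, hp, hP⟩, -⟩ := hfi (st i) (hst i).1 (hst i).2.1
    have : (⟨fi (st i), hi⟩ : Fin I.t) = i := Fin.ext (hst i).2.2
    exact ⟨p.toSubgraph, this.subst (motive := fun j => p.toSubgraph ∈ I.family j) hP, hx, hy, p, hp, rfl⟩
  choose P hP hx hy p hp hPp using hpath
  have hinj : Function.Injective P := fun i j hij => eq_of_mem_family (hP i) (hij ▸ hP j)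
  refine ⟨Set.range P, ?_, ?_, fun i => Set.ncard_eq_one.2 ⟨P i, ?_⟩, fun v hv => ?_⟩
  · rintro _ ⟨i, rfl⟩
    exact I.family_path i _ (hP i)
  · rw [← Set.image_univ, Set.ncard_image_of_injective _ hinj]
    simp
  · ext Q
    constructor
    · rintro ⟨⟨j, rfl⟩, hj⟩
      rw [eq_of_mem_family (hP j) hj]
      rfl
    · rintro rfl
      exact ⟨⟨i, rfl⟩, hP i⟩
  · rcases hbase v v.2 with h1 | ⟨h1, h2, h3, -, -, -, hcov, -⟩
    · exact absurd ⟨v.2, hv⟩ h1.2.1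
    let x : Fin I.n := ⟨_, h1⟩
    let y : Fin I.n := ⟨_, h2⟩
    have hvx : I.F.Reachable v x := D_lt_iff.1 h3
    have hgx : g x = g v := label_start_eq hc _ hvx rfl rfl
    obtain ⟨hi, -, -⟩ := hfi x x.2 (by rw [hgx])
    let i : Fin I.t := ⟨_, hi⟩
    -- Uniqueness of the start in family `i` shows that the path named by the label of `v` is the
    -- selected one.
    have hxi : (x : ℕ) = st i := hst' i x x.2 (by rw [hgx]) rfl
    have hgi : g (st i) = g v := by rw [← hxi, hgx]
    have ex : (⟨_, hx i⟩ : Fin I.n) = x := Fin.ext (congrArg Prod.fst hgi)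
    have ey : (⟨_, hy i⟩ : Fin I.n) = y := Fin.ext (congrArg Prod.snd hgi)
    have hxy : I.F.Reachable x y := by
      have := (p i).reachable
      rwa [ex, ey] at this
    have hle := hcov ⟨v.2, hv⟩
    have e1 : I.D v (g v).1 = I.F.dist v x := D_of_reachable hvx
    have e2 : I.D v (g v).2 = I.F.dist v y := D_of_reachable (hvx.trans hxy)
    have e3 : I.D (g v).1 (g v).2 = I.F.dist x y := D_of_reachable hxy
    rw [e1, e2, e3] at hle
    obtain ⟨u, hu, huv⟩ := exists_mem_support_edist_le I.isForest (hp i) I.ℓ (v := v)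
      (by rw [ex]; exact hvx) (by rw [ex, ey]; omega)
    refine ⟨P i, ⟨i, rfl⟩, u, ?_, huv⟩
    rw [hPp i]
    simpa using hu

/-- Each vertex is labeled with its nearest path in the solution. The main point is `hnext`: the
choice persists on the way to the first end of that path. -/
theorem solvable_of_isYes (h : I.IsYes) :
    Solvable I.Compat (Finset.range (I.n + 1)) I.Base (target I.t) := by
  classical
  obtain ⟨S, -, hcard, hone, hcov⟩ := h
  have hpath : ∀ i, ∃ P, P ∈ S ∧ P ∈ I.family i ∧ ∃ (x y : Fin I.n) (p : I.F.Walk x y), p.IsPath ∧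
      P = p.toSubgraph := fun i => by
    obtain ⟨P, hP⟩ := Set.ncard_eq_one.1 (hone i)
    have : P ∈ S ∩ I.family i := by rw [hP]; rfl
    exact ⟨P, this.1, this.2, I.family_path i P this.2⟩
  choose P hPS hPF x y p hp hPp using hpath
  have hmem : ∀ {i j v}, v ∈ (p i).support → v ∈ (p j).support → i = j := fun {i j v} h h' =>
    eq_of_mem_verts (hPF i) (hPF j) (by rw [hPp i]; simpa using h) (by rw [hPp j]; simpa using h')
  have hinj : Function.Injective P := fun i j hij => eq_of_mem_family (hPF i) (hij ▸ hPF j)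
  have hS : Set.range P = S := by
    refine Set.eq_of_subset_of_ncard_le (Set.range_subset_iff.2 hPS) ?_
    rw [hcard, ← Set.image_univ, Set.ncard_image_of_injective _ hinj]
    simp
  -- Twice the distance from `v` to the path `P i` when both lie in one tree; by `htri` no
  -- truncation occurs then.
  let gr : Fin I.n → Fin I.t → ℕ := fun v i =>
    I.F.dist v (x i) + I.F.dist v (y i) - I.F.dist (x i) (y i)
  have htri : ∀ v i, I.F.Reachable v (x i) →
      I.F.dist (x i) (y i) ≤ I.F.dist v (x i) + I.F.dist v (y i) := fun v i h => by
    have := h.symm.dist_triangle_left (y i)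
    rwa [SimpleGraph.dist_comm (u := x i) (v := v)] at this
  have hzero : ∀ v i, I.F.Reachable v (x i) → gr v i = 0 → v ∈ (p i).support := fun v i h h0 => by
    rw [mem_support_iff_dist I.isForest (hp i) h]
    have := htri v i h
    simp only [gr] at h0
    omega
  let best : Fin I.n → Fin I.t → Prop := fun v i => I.F.Reachable v (x i) ∧
    ∀ j, I.F.Reachable v (x j) → gr v i < gr v j ∨ gr v i = gr v j ∧ (i : ℕ) ≤ j
  have hbest : ∀ v i, I.F.Reachable v (x i) → ∃ i, best v i := fun v i h => by
    obtain ⟨j, hj, hmin⟩ := Finset.exists_min_image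
      (Finset.univ.filter fun i => I.F.Reachable v (x i)) (fun i => toLex (gr v i, (i : ℕ))) ⟨i, by simpa⟩
    refine ⟨j, by simpa using hj, fun k hk => ?_⟩
    simpa [Prod.Lex.le_iff] using hmin k (by simpa)
  have hunique : ∀ v i j, best v i → best v j → i = j := fun v i j hi hj => by
    have h1 := hi.2 j hj.1
    have h2 := hj.2 i hi.1
    apply Fin.ext
    omega
  have hnext : ∀ {v u i}, best v i → I.F.Adj u v → I.F.dist u (x i) + 1 = I.F.dist v (x i) →
      best u i := fun {v u i} hb huv hd => by
    refine ⟨huv.reachable.trans hb.1, fun j hj => ?_⟩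
    have hvj := huv.symm.reachable.trans hj
    have hyi := hb.1.trans (p i).reachable
    have hyj := hvj.trans (p j).reachable
    have h1 := htri u i (huv.reachable.trans hb.1)
    -- If `u` is also closer to `y i`, the excess for `i` drops by two, and no other excess drops by
    -- more, so minimality and tie-breaking persist. Otherwise the edge lies on `P i`, the excess at
    -- `u` is `0`, and disjointness excludes any other path with excess `0`.
    rcases dist_succ_or_succ I.isForest huv hyi with h | h
    · have h2 := hb.2 j hvj
      have h3 := dist_succ_or_succ I.isForest huv hvj
      have h4 := dist_succ_or_succ I.isForest huv hyj
      have h5 := htri u j hj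
      have h6 := htri v j hvj
      simp only [gr] at h2 ⊢
      omega
    · have h2 := dist_add_dist_of_adj I.isForest huv hb.1 hyi hd h
      have h3 : gr u i = 0 := by simp only [gr]; omega
      by_cases h4 : gr u j = 0
      · rw [hmem (hzero u i (huv.reachable.trans hb.1) h3) (hzero u j hj h4)]
        exact .inr ⟨rfl, le_rfl⟩
      · omega
  have hself : ∀ i, best (x i) i := fun i => by
    have h0 : gr (x i) i = 0 := by simp [gr]
    refine ⟨SimpleGraph.Reachable.refl _, fun j hj => ?_⟩
    by_cases h4 : gr (x i) j = 0
    · rw [hmem (p i).start_mem_support (hzero (x i) j hj h4)]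
      exact .inr ⟨rfl, le_rfl⟩
    · omega
  have ho : ∀ v, ∃ o : Option (Fin I.t), ∀ i, o = some i ↔ best v i := fun v => by
    by_cases h : ∃ i, best v i
    · obtain ⟨i, hi⟩ := h
      exact ⟨some i, fun j => ⟨fun h => by cases h; exact hi, fun h => by rw [hunique v i j hi h]⟩⟩
    · exact ⟨none, fun i => ⟨fun h => by simp at h, fun h' => absurd ⟨i, h'⟩ h⟩⟩
  choose o ho using ho
  let lab : Option (Fin I.t) → ℕ × ℕ := fun o => o.elim (I.n, 0) fun i => (x i, y i)
  let g : ℕ → ℕ × ℕ := fun v => if h : v < I.n then lab (o ⟨v, h⟩) else (I.n, 0)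
  let f : ℕ → ℕ := fun v => if h : v < I.n then
    (o ⟨v, h⟩).elim 0 fun i => if (x i : ℕ) = v then weight I.t i else 0 else 0
  have hg : ∀ v : Fin I.n, g v = lab (o v) := fun v => dif_pos v.2
  have hf : ∀ v : Fin I.n, f v = (o v).elim 0 fun i => if (x i : ℕ) = v then weight I.t i else 0 :=
    fun v => dif_pos v.2
  have hcompat : ∀ {v u : Fin I.n}, I.F.Adj u v → (lab (o v)).1 < I.n →
      I.D u (lab (o v)).1 + 1 = I.D v (lab (o v)).1 → lab (o u) = lab (o v) := by
    intro v u huv h1 h2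
    rcases hov : o v with _ | i
    · rw [hov] at h1
      exact absurd h1 (lt_irrefl _)
    · have hb := (ho v i).1 hov
      rw [hov] at h2
      change I.D u (x i) + 1 = I.D v (x i) at h2
      rw [D_of_reachable hb.1, D_of_reachable (huv.reachable.trans hb.1)] at h2
      rw [(ho u i).2 (hnext hb huv h2)]
  refine ⟨g, f, fun v hv => ?_, fun v _ u _ _ hadj => ?_, ?_⟩
  · have hv := Finset.mem_range.1 hv
    by_cases hvn : v = I.n
    · have h1 : g v = (I.n, 0) := dif_neg (by omega)
      have h2 : f v = 0 := dif_neg (by omega)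
      rw [Base, if_pos hvn, h1, h2]
      simp
    obtain ⟨v, rfl⟩ : ∃ v' : Fin I.n, v = v' := ⟨⟨v, by omega⟩, rfl⟩
    have hB : v ∈ I.B → ∃ i, I.F.Reachable v (x i) ∧
        I.F.dist v (x i) + I.F.dist v (y i) ≤ I.F.dist (x i) (y i) + 2 * I.ℓ := fun h => by
      obtain ⟨Q, hQ, u, hu, huv⟩ := hcov v h
      rw [← hS] at hQ
      obtain ⟨i, rfl⟩ := hQ
      rw [hPp i] at hu
      exact ⟨i, dist_add_dist_le_of_edist_le I.isForest (hp i) (by simpa using hu) huv⟩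
    rw [Base, if_neg hvn, hg, hf]
    rcases hov : o v with _ | i
    · refine ⟨le_rfl, Nat.zero_le _, .inl ⟨rfl, fun ⟨h1, h2⟩ => ?_, rfl⟩⟩
      obtain ⟨i, hi, -⟩ := hB h2
      obtain ⟨j, hj⟩ := hbest v i hi
      rw [(ho v j).2 hj] at hov
      simp at hov
    · have hb := (ho v i).1 hov
      have hxy := (p i).reachable
      refine ⟨(x i).2.le, (y i).2.le, .inr ⟨(x i).2, (y i).2, D_lt_iff.2 hb.1, i, i.2,
        ⟨i.2, (x i).2, (y i).2, p i, hp i, hPp i ▸ hPF i⟩, fun ⟨h1, h2⟩ => ?_, rfl⟩⟩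
      change I.D v (x i) + I.D v (y i) ≤ I.D (x i) (y i) + (I.ℓ + I.ℓ)
      rw [D_of_reachable hb.1, D_of_reachable (hb.1.trans hxy), D_of_reachable hxy]
      obtain ⟨j, hj, hle⟩ := hB h2
      have h3 := hb.2 j hj
      have h4 := htri v i hb.1
      have h5 := htri v j hj
      simp only [gr] at h3
      omega
  · obtain ⟨v, rfl⟩ : ∃ v' : Fin I.n, v = v' := ⟨⟨v, hadj.1⟩, rfl⟩
    obtain ⟨u, rfl⟩ : ∃ u' : Fin I.n, u = u' := ⟨⟨u, hadj.2.1⟩, rfl⟩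
    have huv : I.F.Adj v u := hadj.2.2
    rw [hg, hg]
    exact ⟨fun h1 h2 => hcompat huv.symm h1 h2, fun h1 h2 => (hcompat huv h1 h2).symm⟩
  · have hfn : f I.n = 0 := dif_neg (lt_irrefl _)
    -- By `hself` the vertex `x i` is labeled with path `i`, so each path is charged exactly once.
    have hsum : ∀ v : Fin I.n, f v = ∑ i : Fin I.t, if v = x i then weight I.t i else 0 := by
      intro v
      rw [hf]
      have hx : ∀ i, v = x i → o v = some i := fun i h => (ho v i).2 (h ▸ hself i)
      by_cases h : ∃ i, v = x i
      · obtain ⟨i, hi⟩ := h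
        rw [Finset.sum_eq_single i (fun j _ hj => if_neg fun h => hj ?_) (by simp), hx i hi]
        · simp [hi]
        · have := (hx i hi).symm.trans (hx j h)
          simpa using this.symm
      · rw [Finset.sum_eq_zero fun i _ => if_neg fun h' => h ⟨i, h'⟩]
        rcases o v with _ | i
        · rfl
        · exact if_neg fun h' => h ⟨i, Fin.ext h'.symm⟩
    rw [Finset.sum_range_succ, hfn, add_zero, ← Fin.sum_univ_eq_sum_range, ← sum_weight,
      ← Fin.sum_univ_eq_sum_range (weight I.t)]
    simp only [hsum]
    rw [Finset.sum_comm]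
    simp

theorem isYes_iff : I.IsYes ↔ Solvable I.Compat (Finset.range (I.n + 1)) I.Base (target I.t) :=
  ⟨solvable_of_isYes, isYes_of_solvable⟩

end Instance

/-! ## Reading the encoding -/

theorem length_flatMap_const {α β : Type*} (l : List α) (F : α → List β) (b : ℕ)
    (hF : ∀ a, (F a).length = b) : (l.flatMap F).length = l.length * b := by
  induction l with
  | nil => simp
  | cons a l ih => rw [List.flatMap_cons, List.length_append, hF, ih, List.length_cons]; ring

/-- Row-major addressing; the matrices of the families need it twice, for the family and for the
row. -/
theorem getD_flatMap_const {α β : Type*} (l : List α) (F : α → List β) (b : ℕ)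
    (hF : ∀ a, (F a).length = b) (d : β) (i j : ℕ) (hi : i < l.length) (hj : j < b) :
    (l.flatMap F).getD (i * b + j) d = (F l[i]).getD j d := by
  induction l generalizing i with
  | nil => simp at hi
  | cons a l ih =>
    rw [List.flatMap_cons]
    cases i with
    | zero =>
      rw [List.getD_append _ _ _ _ (by rw [hF]; omega)]
      simp
    | succ i =>
      rw [List.getD_append_right _ _ _ _ (by rw [hF, add_mul]; omega), hF,
        show (i + 1) * b + j - b = i * b + j by rw [add_mul]; omega,
        ih i (by simpa using hi)]
      simp

theorem getD_map_finRange {β : Type*} {n : ℕ} (f : Fin n → β) (d : β) (j : Fin n) :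
    ((List.finRange n).map f).getD j d = f j := by
  simp [List.getD_eq_getElem?_getD]

theorem bit_ne_zero {p : Prop} : bit p ≠ 0 ↔ p := by
  unfold bit
  split_ifs with h <;> simp [h]

namespace Instance

variable (I : Instance)

/-- The input array. -/
noncomputable def input (j : ℕ) : ℕ := I.encode.getD j 0

theorem input_one : I.input 1 = I.ℓ := rfl

variable {I}

theorem input_adj {u v : ℕ} (hu : u < I.n) (hv : v < I.n) :
    I.input (3 + (u * I.n + v)) ≠ 0 ↔ I.Adj u v := by
  have hlen : u * I.n + v < I.n * I.n := by nlinarith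
  have hL : ∀ u : Fin I.n, ((List.finRange I.n).map fun v => bit (I.F.Adj u v)).length = I.n := by simp
  rw [input, encode, List.append_assoc, List.append_assoc, List.getD_append_right _ _ _ _ (by simp),
    List.getD_append _ _ _ _ (by
      rw [length_flatMap_const _ _ _ hL, List.length_finRange]; simpa using hlen)]
  simp only [List.length_cons, List.length_nil, zero_add, Nat.reduceAdd, Nat.add_sub_cancel_left]
  rw [getD_flatMap_const _ _ _ hL _ _ _ (by simpa) hv, List.getElem_finRange]
  refine Iff.trans ?_ (Iff.trans (bit_ne_zero (p := I.F.Adj ⟨u, hu⟩ ⟨v, hv⟩)) ?_)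
  · exact not_congr (Eq.congr (getD_map_finRange _ 0 ⟨v, hv⟩) rfl)
  · exact ⟨fun h => ⟨hu, hv, h⟩, fun h => h.2.2⟩

theorem input_memB {v : ℕ} (hv : v < I.n) : I.input (3 + I.n * I.n + v) ≠ 0 ↔ I.MemB v := by
  have hL : ∀ u : Fin I.n, ((List.finRange I.n).map fun v => bit (I.F.Adj u v)).length = I.n := by simp
  rw [input, encode, List.append_assoc, List.append_assoc, List.getD_append_right _ _ _ _ (by simp; omega),
    List.getD_append_right _ _ _ _ (by
      rw [length_flatMap_const _ _ _ hL, List.length_finRange]; simp; omega),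
    length_flatMap_const _ _ _ hL, List.length_finRange,
    show 3 + I.n * I.n + v - [I.n, I.ℓ, I.t].length - I.n * I.n = v by simp; omega,
    List.getD_append _ _ _ _ (by simpa)]
  refine Iff.trans ?_ (Iff.trans (bit_ne_zero (p := (⟨v, hv⟩ : Fin I.n) ∈ I.B)) ?_)
  · exact not_congr (Eq.congr (getD_map_finRange _ 0 ⟨v, hv⟩) rfl)
  · exact ⟨fun h => ⟨hv, h⟩, fun h => h.2⟩

theorem input_fam {i x y : ℕ} (hi : i < I.t) (hx : x < I.n) (hy : y < I.n) :
    I.input (3 + I.n * I.n + I.n + ((i * I.n + x) * I.n + y)) ≠ 0 ↔ I.Fam i x y := by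
  have hL : ∀ u : Fin I.n, ((List.finRange I.n).map fun v => bit (I.F.Adj u v)).length = I.n := by simp
  have hL' : ∀ (i : Fin I.t) (u : Fin I.n), ((List.finRange I.n).map fun v =>
      bit (∃ p : I.F.Walk u v, p.IsPath ∧ p.toSubgraph ∈ I.family i)).length = I.n := by simp
  have hL'' : ∀ (i : Fin I.t), ((List.finRange I.n).flatMap fun u => (List.finRange I.n).map fun v =>
      bit (∃ p : I.F.Walk u v, p.IsPath ∧ p.toSubgraph ∈ I.family i)).length = I.n * I.n := fun i => by
    rw [length_flatMap_const _ _ _ (hL' i), List.length_finRange]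
  have hxy : x * I.n + y < I.n * I.n := by nlinarith
  rw [input, encode, List.append_assoc, List.append_assoc, List.getD_append_right _ _ _ _ (by simp; omega),
    List.getD_append_right _ _ _ _ (by
      rw [length_flatMap_const _ _ _ hL, List.length_finRange]; simp; omega),
    length_flatMap_const _ _ _ hL, List.length_finRange,
    show 3 + I.n * I.n + I.n + ((i * I.n + x) * I.n + y) - [I.n, I.ℓ, I.t].length - I.n * I.n =
      I.n + (i * (I.n * I.n) + (x * I.n + y)) by
        have : (i * I.n + x) * I.n = i * (I.n * I.n) + x * I.n := by ring
        simp; omega,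
    List.getD_append_right _ _ _ _ (by simp), List.length_map, List.length_finRange,
    Nat.add_sub_cancel_left, getD_flatMap_const _ _ _ hL'' _ _ _ (by simpa) hxy, List.getElem_finRange,
    getD_flatMap_const _ _ _ (hL' _) _ _ _ (by simpa) hy, List.getElem_finRange]
  refine Iff.trans ?_ (Iff.trans (bit_ne_zero (p := ∃ p : I.F.Walk ⟨x, hx⟩ ⟨y, hy⟩, p.IsPath ∧
    p.toSubgraph ∈ I.family ⟨i, hi⟩)) ?_)
  · exact not_congr (Eq.congr (getD_map_finRange _ 0 ⟨y, hy⟩) rfl)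
  · exact ⟨fun h => ⟨hi, hx, hy, h⟩, fun h => h.2.2.2⟩

end Instance

/-! ## Terms as formulas -/

namespace Tm

/-- A term is regarded as true if its value is not `0`. -/
def Holds (e : Tm) (σ : State) : Prop := e.eval σ ≠ 0

def and (a b : Tm) : Tm := .ite a b (.lit 0)
def or (a b : Tm) : Tm := .ite a (.lit 1) b
def imp (a b : Tm) : Tm := .ite a b (.lit 1)
def not (a : Tm) : Tm := .ite a (.lit 0) (.lit 1)
def le (a b : Tm) : Tm := .lt a (.add b (.lit 1))

/-- The number of values of `x` below `b` for which `e` holds. -/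
def card (x b : ℕ) (e : Tm) : Tm := .sum x b (.ite e (.lit 1) (.lit 0))

variable {a b c : Tm} {σ : State}

@[simp] theorem holds_and : (a.and b).Holds σ ↔ a.Holds σ ∧ b.Holds σ := by
  by_cases h : a.eval σ = 0 <;> simp [Holds, and, eval, h]

@[simp] theorem holds_or : (a.or b).Holds σ ↔ a.Holds σ ∨ b.Holds σ := by
  by_cases h : a.eval σ = 0 <;> simp [Holds, or, eval, h]

@[simp] theorem holds_imp : (a.imp b).Holds σ ↔ (a.Holds σ → b.Holds σ) := by
  by_cases h : a.eval σ = 0 <;> simp [Holds, imp, eval, h]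

@[simp] theorem holds_not : (a.not).Holds σ ↔ ¬ a.Holds σ := by
  by_cases h : a.eval σ = 0 <;> simp [Holds, not, eval, h]

@[simp] theorem holds_lt : (a.lt b).Holds σ ↔ a.eval σ < b.eval σ := by simp [Holds, eval]

@[simp] theorem holds_le : (a.le b).Holds σ ↔ a.eval σ ≤ b.eval σ := by
  simp [Holds, eval, le]

@[simp] theorem holds_eq : (a.eq b).Holds σ ↔ a.eval σ = b.eval σ := by simp [Holds, eval]

@[simp] theorem holds_get {z : ℕ} : (get z a).Holds σ ↔ σ.arr z (a.eval σ) ≠ 0 := Iff.rfl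

-- A sum of natural numbers is nonzero exactly if some summand is, so bounded sums serve as bounded
-- existential quantifiers.
@[simp] theorem holds_sum {x z : ℕ} : (sum x z a).Holds σ ↔ ∃ i < σ.var z, a.Holds (σ.setVar x i) := by
  simp [Holds, eval]

theorem holds_ite_of_holds (h : a.Holds σ) : (Tm.ite a b c).Holds σ ↔ b.Holds σ := by
  unfold Holds at *
  rw [eval, if_pos h]

theorem holds_ite_of_not_holds (h : ¬ a.Holds σ) : (Tm.ite a b c).Holds σ ↔ c.Holds σ := by
  unfold Holds at *
  rw [eval, if_neg h]

@[simp] theorem eval_lit {z : ℕ} : (lit z).eval σ = z := rfl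
@[simp] theorem eval_var {z : ℕ} : (var z).eval σ = σ.var z := rfl
@[simp] theorem eval_get {z : ℕ} : (get z a).eval σ = σ.arr z (a.eval σ) := rfl
@[simp] theorem eval_add : (a.add b).eval σ = a.eval σ + b.eval σ := rfl
@[simp] theorem eval_sub : (a.sub b).eval σ = a.eval σ - b.eval σ := rfl
@[simp] theorem eval_mul {z : ℕ} : (a.mul z).eval σ = a.eval σ * σ.var z := rfl

open Classical in
@[simp] theorem eval_ite : (Tm.ite a b c).eval σ = if a.Holds σ then b.eval σ else c.eval σ := by
  by_cases h : a.eval σ = 0 <;> simp [Holds, eval, h]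

open Classical in
@[simp] theorem eval_card {x z : ℕ} : (a.card x z).eval σ =
    ((Finset.range (σ.var z)).filter fun i => a.Holds (σ.setVar x i)).card := by
  rw [Finset.card_filter]
  refine Finset.sum_congr rfl fun i _ => ?_
  by_cases h : a.eval (σ.setVar x i) = 0 <;> simp [Holds, eval, h]

end Tm

/-! ### Invariants of iterations and the effect of row updates -/

theorem Cmd.exec_iter_induction {x b : ℕ} {p : Cmd} {σ : State} (J : ℕ → State → Prop) (h0 : J 0 σ)
    (hstep : ∀ i < σ.var b, ∀ τ, J i τ → J (i + 1) (p.exec (τ.setVar x i))) :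
    J (σ.var b) ((Cmd.iter x b p).exec σ) := by
  suffices H : ∀ k ≤ σ.var b, J k (Nat.rec σ (fun i τ => p.exec (τ.setVar x i)) k) from H _ le_rfl
  intro k
  induction k with
  | zero => exact fun _ => h0
  | succ k ih => exact fun hk => hstep k (by omega) _ (ih (by omega))

@[simp] theorem State.fill_var (σ : State) (a row len : ℕ) (g : ℕ → ℕ) :
    (σ.fill a row len g).var = σ.var := rfl

theorem State.fill_arr_of_ne (σ : State) {a b : ℕ} (h : b ≠ a) (row len : ℕ) (g : ℕ → ℕ) :
    (σ.fill a row len g).arr b = σ.arr b := by simp [State.fill, h]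

theorem State.fill_arr_self (σ : State) (a row len : ℕ) (g : ℕ → ℕ) {j : ℕ} (hj : j < len) :
    (σ.fill a row len g).arr a (row * len + j) = g j := by simp [State.fill, hj]

theorem State.fill_arr_zero (σ : State) (a len : ℕ) (g : ℕ → ℕ) {j : ℕ} (hj : j < len) :
    (σ.fill a 0 len g).arr a j = g j := by simp [State.fill, hj]

theorem State.fill_arr_of_row_ne (σ : State) (a : ℕ) {row row' : ℕ} (h : row' ≠ row) (len : ℕ)
    (g : ℕ → ℕ) {j : ℕ} (hj : j < len) :
    (σ.fill a row len g).arr a (row' * len + j) = σ.arr a (row' * len + j) := by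
  simp only [State.fill, Function.update_self]
  refine if_neg fun ⟨h1, h2⟩ => h ?_
  have e1 : (row' * len + j) / len = row' := by
    rw [mul_comm, Nat.mul_add_div (by omega), Nat.div_eq_of_lt hj, add_zero]
  rw [← e1]
  exact Nat.div_eq_of_lt_le h1 (by rw [add_mul, one_mul]; exact h2)

theorem mul_add_inj {m a b a' b' : ℕ} (hb : b < m) (hb' : b' < m) :
    a * m + b = a' * m + b' ↔ a = a' ∧ b = b' := by
  refine ⟨fun h => ?_, fun h => by rw [h.1, h.2]⟩
  have h1 := congrArg (· / m) h
  simp only [mul_comm _ m, Nat.mul_add_div (by omega : m > 0), Nat.div_eq_of_lt hb,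
    Nat.div_eq_of_lt hb', add_zero] at h1
  subst h1
  exact ⟨rfl, by omega⟩

/-! ## The algorithm

The variables `0, ..., 4` hold `n`, `t`, `n + 1`, `4 ^ t` and `4 ^ t * (n + 1) * (n + 1)`; the arrays
`0, ..., 4` hold the input, the distances, the powers of two, the constraints of the vertices, and the
marks of the eliminated vertices. -/

namespace Tm

/-- In the encoding, cells `0, 1, 2` hold the parameters, followed by `n * n` cells for adjacency,
`n` cells for `B`, and `n * n` cells per family. The second argument of `mul` is the number of a
variable: `0` stands for the factor `n`. -/
def adj (u v : Tm) : Tm := .get 0 (.add (.lit 3) (.add (.mul u 0) v))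
def memB (v : Tm) : Tm := .get 0 (.add (.add (.lit 3) (.mul (.var 0) 0)) v)
def fam (i x y : Tm) : Tm := .get 0 (.add (.add (.add (.lit 3) (.mul (.var 0) 0)) (.var 0))
  (.add (.mul (.add (.mul i 0) x) 0) y))
def dist (u v : Tm) : Tm := .get 1 (.add (.mul u 2) v)
-- Mixed radix notation: variables `2` and `3` hold the radices `n + 1` and `4 ^ t`.
def code (x y w : Tm) : Tm := .add (.mul (.add (.mul x 2) y) 3) w
def table (v x y w : Tm) : Tm := .get 3 (.add (.mul v 4) (code x y w))

/-- One step of the computation of distances. -/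
def distStep : Tm := card 9 0 (.sum 10 2 (.sum 11 2 (.and (.eq (.var 8) (.add (.mul (.var 10) 2) (.var 11)))
  (.and (.not (.eq (.var 10) (.var 11)))
    (.not (.sum 12 0 (.and (adj (.var 10) (.var 12)) (.lt (dist (.var 12) (.var 11)) (.var 9)))))))))

/-- A round rewrites the array from its old contents, so correctness advances by one entry per
round. -/
def powStep : Tm := .ite (.eq (.var 8) (.lit 0)) (.lit 1)
  (.add (.get 2 (.sub (.var 8) (.lit 1))) (.get 2 (.sub (.var 8) (.lit 1))))

/-- The constraint for the vertex `7` with the label `(9, 10)` and the weight `11`. -/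
def base : Tm := .ite (.eq (.var 7) (.var 0)) (.eq (.var 11) (.lit 0))
  (.or (.and (.eq (.var 9) (.var 0)) (.and (.not (memB (.var 7))) (.eq (.var 11) (.lit 0))))
    (.and (.lt (.var 9) (.var 0)) (.and (.lt (.var 10) (.var 0))
      (.and (.lt (dist (.var 7) (.var 9)) (.var 0)) (.sum 12 1 (.and (fam (.var 12) (.var 9) (.var 10))
        (.and (.imp (memB (.var 7)) (.le (.add (dist (.var 7) (.var 9)) (dist (.var 7) (.var 10)))
          (.add (dist (.var 9) (.var 10)) (.add (.get 0 (.lit 1)) (.get 0 (.lit 1))))))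
        (.eq (.var 11) (.ite (.eq (.var 9) (.var 7)) (.add (.get 2 (.var 12)) (.get 2 (.var 1)))
          (.lit 0))))))))))

def baseEntry : Tm := .sum 9 2 (.sum 10 2 (.sum 11 3 (.and
  (.eq (.var 8) (code (.var 9) (.var 10) (.var 11))) base)))

/-- The vertex `10` is not eliminated and has at most one neighbor that is not eliminated. -/
def leaf : Tm := .and (.lt (.var 10) (.var 0)) (.and (.not (.get 4 (.var 10)))
  (.not (.sum 11 0 (.sum 12 0 (.and (.not (.get 4 (.var 11))) (.and (.not (.get 4 (.var 12)))
    (.and (adj (.var 10) (.var 11)) (.and (adj (.var 10) (.var 12))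
      (.not (.eq (.var 11) (.var 12)))))))))))

/-- The vertex `10` is a neighbor of `5` that is not eliminated, or the additional vertex. -/
def parent : Tm := .or (.eq (.var 10) (.var 0)) (.and (.lt (.var 10) (.var 0))
  (.and (.not (.get 4 (.var 10))) (adj (.var 5) (.var 10))))

/-- Counting the values of variable `9` that pass this test gives the least value of variable `10`
satisfying `e`, if there is one below the bound. -/
def notUpTo (e : Tm) : Tm := .not (.sum 10 4 (.and (.le (.var 10) (.var 9)) e))

/-- The constraint for the labels `(9, 10)` of the vertex `6` and `(13, 14)` of the vertex `5`. -/
def compat : Tm := .or (.eq (.var 6) (.var 0)) (.and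
  (.imp (.lt (.var 9) (.var 0)) (.imp (.eq (.add (dist (.var 5) (.var 9)) (.lit 1)) (dist (.var 6) (.var 9)))
    (.and (.eq (.var 13) (.var 9)) (.eq (.var 14) (.var 10)))))
  (.imp (.lt (.var 13) (.var 0)) (.imp (.eq (.add (dist (.var 6) (.var 13)) (.lit 1)) (dist (.var 5) (.var 13)))
    (.and (.eq (.var 13) (.var 9)) (.eq (.var 14) (.var 10))))))

def mergeEntry : Tm := .sum 9 2 (.sum 10 2 (.sum 11 3 (.sum 12 3 (.sum 13 2 (.sum 14 2
  (.and (.lt (.add (.var 11) (.var 12)) (.var 3))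
  (.and (.eq (.var 8) (code (.var 9) (.var 10) (.add (.var 11) (.var 12))))
  (.and (table (.var 6) (.var 9) (.var 10) (.var 11))
  (.and (table (.var 5) (.var 13) (.var 14) (.var 12)) compat)))))))))

def accept : Tm := .sum 9 2 (.sum 10 2 (table (.var 0) (.var 9) (.var 10)
  (.add (.sub (.get 2 (.var 1)) (.lit 1)) (.mul (.get 2 (.var 1)) 1))))

end Tm

namespace Cmd

def distances : Cmd := .iter 7 0 (.fill 1 (.lit 0) 8 4 .distStep)
def powers : Cmd := .iter 7 4 (.fill 2 (.lit 0) 8 4 .powStep)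
def constraints : Cmd := .iter 7 2 (.fill 3 (.var 7) 8 4 .baseEntry)
-- Variable `5` receives the leaf and variable `6` the vertex that absorbs it, whose row is then
-- replaced by the merged constraints.
def eliminate : Cmd := .seq (.count 5 9 4 (.notUpTo .leaf)) (.seq (.count 6 9 4 (.notUpTo .parent))
  (.seq (.fill 3 (.var 6) 8 4 .mergeEntry)
    (.fill 4 (.lit 0) 8 4 (.or (.get 4 (.var 8)) (.eq (.var 8) (.var 5))))))
def main : Cmd := .seq distances (.seq powers (.seq constraints (.iter 7 0 eliminate)))

end Cmd

variable {I : Instance}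

/-- The number of configurations of a vertex. -/
def Instance.size (I : Instance) : ℕ := 4 ^ I.t * (I.n + 1) * (I.n + 1)

/-- The number of a configuration. -/
def Instance.code (I : Instance) (x y w : ℕ) : ℕ := (x * (I.n + 1) + y) * 4 ^ I.t + w

/-- The parameters of the instance and the input are in place. -/
structure Ready (I : Instance) (σ : State) : Prop where
  n : σ.var 0 = I.n
  t : σ.var 1 = I.t
  m : σ.var 2 = I.n + 1
  K : σ.var 3 = 4 ^ I.t
  N : σ.var 4 = I.size
  input : σ.arr 0 = I.input

theorem Ready.setVar {σ : State} (h : Ready I σ) {x : ℕ} (hx : 5 ≤ x) (v : ℕ) : Ready I (σ.setVar x v) := by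
  constructor
  · rw [State.setVar_var, if_neg (by omega), h.n]
  · rw [State.setVar_var, if_neg (by omega), h.t]
  · rw [State.setVar_var, if_neg (by omega), h.m]
  · rw [State.setVar_var, if_neg (by omega), h.K]
  · rw [State.setVar_var, if_neg (by omega), h.N]
  · exact h.input

theorem Ready.fill {σ : State} (h : Ready I σ) {a : ℕ} (ha : 1 ≤ a) (row len : ℕ) (g : ℕ → ℕ) :
    Ready I (σ.fill a row len g) :=
  ⟨h.n, h.t, h.m, h.K, h.N, by rw [State.fill_arr_of_ne _ (by omega), h.input]⟩

theorem Instance.code_inj {x y w x' y' w' : ℕ} (hy : y < I.n + 1) (hw : w < 4 ^ I.t)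
    (hy' : y' < I.n + 1) (hw' : w' < 4 ^ I.t) :
    I.code x y w = I.code x' y' w' ↔ x = x' ∧ y = y' ∧ w = w' := by
  rw [Instance.code, Instance.code, mul_add_inj hw hw', mul_add_inj hy hy', and_assoc]

theorem mul_add_lt {a b m k : ℕ} (ha : a < k) (hb : b < m) : a * m + b < k * m := by
  have : (a + 1) * m ≤ k * m := Nat.mul_le_mul_right _ ha
  rw [add_mul] at this
  omega

theorem Instance.code_lt {x y w : ℕ} (hx : x < I.n + 1) (hy : y < I.n + 1) (hw : w < 4 ^ I.t) :
    I.code x y w < I.size := by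
  rw [Instance.size, mul_assoc, mul_comm (4 ^ I.t)]
  exact mul_add_lt (mul_add_lt hx hy) hw

theorem Instance.sq_le_size : (I.n + 1) * (I.n + 1) ≤ I.size := by
  rw [Instance.size, mul_assoc]
  exact Nat.le_mul_of_pos_left _ (by positivity)

theorem Instance.n_lt_size : I.n < I.size := lt_of_lt_of_le (by nlinarith) I.sq_le_size

theorem Instance.pow_le_size : 4 ^ I.t ≤ I.size := by
  rw [Instance.size, mul_assoc]
  exact Nat.le_mul_of_pos_right _ (by positivity)

theorem Instance.t_lt_size : I.t < I.size :=
  (Nat.lt_pow_self (by norm_num : 1 < 4)).trans_le I.pow_le_size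

/-! ### Precomputation of distances, powers of two and local constraints -/

/-- The distances are in place. -/
def HasDist (I : Instance) (σ : State) : Prop :=
  ∀ u < I.n, ∀ v < I.n, σ.arr 1 (u * (I.n + 1) + v) = I.D u v

/-- The powers of two are in place. -/
def HasPow (I : Instance) (σ : State) : Prop := ∀ i ≤ I.t, σ.arr 2 i = 2 ^ i

-- For `u ≠ v` the count is the minimum of `n` and one plus the least current value at a neighbor of
-- `u`: a Bellman–Ford step with `n` as infinity.
open Classical in
theorem eval_distStep {σ : State} (h : Ready I σ) {u v : ℕ} (hu : u < I.n) (hv : v < I.n) :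
    Tm.distStep.eval (σ.setVar 8 (u * (I.n + 1) + v)) = ((Finset.range I.n).filter fun y =>
      u ≠ v ∧ ∀ w < I.n, I.Adj u w → y ≤ σ.arr 1 (w * (I.n + 1) + v)).card := by
  simp only [Tm.distStep, Tm.eval_card, Tm.adj, Tm.dist]
  simp [h.n, h.m, h.input]
  congr 1
  refine Finset.filter_congr fun y _ => ?_
  constructor
  · rintro ⟨u', hu', v', hv', he, hne, hall⟩
    obtain ⟨rfl, rfl⟩ := (mul_add_inj (by omega) (by omega)).1 he
    exact ⟨hne, fun w hw ha => hall w hw ((Instance.input_adj hu hw).2 ha)⟩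
  · rintro ⟨hne, hall⟩
    exact ⟨u, by omega, v, by omega, rfl, hne, fun w hw ha => hall w hw ((Instance.input_adj hu hw).1 ha)⟩

namespace Instance

theorem D_self {u : ℕ} (hu : u < I.n) : I.D u u = 0 := by
  simpa using D_of_reachable (I := I) (SimpleGraph.Reachable.refl ⟨u, hu⟩)

theorem D_le {u v : ℕ} (hu : u < I.n) (hv : v < I.n) : I.D u v ≤ I.n := by
  by_cases h : I.F.Reachable ⟨u, hu⟩ ⟨v, hv⟩
  · exact (D_lt_iff.2 h).le
  · exact (D_of_not_reachable h).le

theorem D_le_succ {u w v : ℕ} (h : I.Adj u w) (hv : v < I.n) : I.D u v ≤ I.D w v + 1 := by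
  obtain ⟨hu, hw, ha⟩ := h
  by_cases hr : I.F.Reachable ⟨w, hw⟩ ⟨v, hv⟩
  · have e1 : I.D w v = _ := D_of_reachable hr
    have e2 : I.D u v = _ := D_of_reachable (ha.reachable.trans hr)
    have := ha.reachable.dist_triangle_left ⟨v, hv⟩
    rw [SimpleGraph.dist_eq_one_iff_adj.2 ha] at this
    omega
  · have e1 : I.D w v = _ := D_of_not_reachable hr
    have := D_le hu hv
    omega

theorem exists_adj_D_succ {u v : ℕ} (hu : u < I.n) (hv : v < I.n) (hne : u ≠ v) (h : I.D u v < I.n) :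
    ∃ w < I.n, I.Adj u w ∧ I.D w v + 1 = I.D u v := by
  have hr : I.F.Reachable ⟨u, hu⟩ ⟨v, hv⟩ := D_lt_iff.1 h
  obtain ⟨w, hw, hd⟩ := exists_adj_dist_succ hr (by simpa using hne)
  have e1 : I.D u v = _ := D_of_reachable hr
  have e2 : I.D w v = _ := D_of_reachable (hw.reachable.trans hr)
  exact ⟨w, w.2, ⟨hu, w.2, hw.symm⟩, by omega⟩

end Instance

/-- Starting from zeros, the values approach the distances from below: after `r` rounds they lie
between `min r (I.D u v)` and `I.D u v`. As `I.D u v ≤ n`, after `n` rounds they are exact,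
including the value `n` for different trees. -/
theorem exec_distances {σ : State} (h : Ready I σ) (h0 : ∀ j, σ.arr 1 j = 0) :
    Ready I (Cmd.distances.exec σ) ∧ (∀ a ≠ 1, (Cmd.distances.exec σ).arr a = σ.arr a) ∧
      HasDist I (Cmd.distances.exec σ) := by
  classical
  have key := Cmd.exec_iter_induction (x := 7) (b := 0) (p := .fill 1 (.lit 0) 8 4 .distStep) (σ := σ)
    (fun r τ => Ready I τ ∧ (∀ a ≠ 1, τ.arr a = σ.arr a) ∧ ∀ u < I.n, ∀ v < I.n,
      τ.arr 1 (u * (I.n + 1) + v) ≤ I.D u v ∧ min r (I.D u v) ≤ τ.arr 1 (u * (I.n + 1) + v))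
    ⟨h, fun _ _ => rfl, fun u _ v _ => by simp [h0]⟩ ?_
  · rw [h.n] at key
    refine ⟨key.1, key.2.1, fun u hu v hv => ?_⟩
    have h1 := key.2.2 u hu v hv
    rw [min_eq_right (Instance.D_le hu hv)] at h1
    exact le_antisymm h1.1 h1.2
  · rintro r - τ ⟨hτ, ha, hD⟩
    have hτ' := hτ.setVar (x := 7) (by norm_num) r
    refine ⟨hτ'.fill le_rfl _ _ _, fun a h1 => ?_, fun u hu v hv => ?_⟩
    · exact (State.fill_arr_of_ne _ h1 _ _ _).trans (ha a h1)
    · have hj : u * (I.n + 1) + v < (τ.setVar 7 r).var 4 := by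
        rw [hτ'.N]
        exact (mul_add_lt (by omega) (by omega)).trans_le I.sq_le_size
      have e : ((Cmd.fill 1 (.lit 0) 8 4 .distStep).exec (τ.setVar 7 r)).arr 1 (u * (I.n + 1) + v) = _ :=
        State.fill_arr_zero _ _ _ _ hj
      rw [e, eval_distStep hτ' hu hv]
      constructor
      · rcases eq_or_ne u v with huv | huv
        · simp [huv]
        rcases lt_or_ge (I.D u v) I.n with hlt | hge
        · obtain ⟨w, hw, haw, hd⟩ := Instance.exists_adj_D_succ hu hv huv hlt
          refine (Finset.card_le_card (t := Finset.range (I.D u v)) fun y hy => ?_).trans (by simp)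
          have h1 := (Finset.mem_filter.1 hy).2.2 w hw haw
          have h2 := (hD w hw v hv).1
          simp only [State.setVar_arr] at h1
          simp only [Finset.mem_range]
          omega
        · exact ((Finset.card_filter_le _ _).trans (by simp)).trans hge
      · refine le_trans (by simp) (Finset.card_le_card (s := Finset.range (min (r + 1) (I.D u v)))
          fun y hy => ?_)
        have hy := Finset.mem_range.1 hy
        have := Instance.D_le hu hv
        refine Finset.mem_filter.2 ⟨Finset.mem_range.2 (by omega), fun huv => ?_, fun w hw haw => ?_⟩
        · rw [huv, Instance.D_self hv] at hy
          omega
        · have h1 := (hD w hw v hv).2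
          have h2 := Instance.D_le_succ haw hv
          simp only [State.setVar_arr]
          omega

theorem exec_powers {σ : State} (h : Ready I σ) :
    Ready I (Cmd.powers.exec σ) ∧ (∀ a ≠ 2, (Cmd.powers.exec σ).arr a = σ.arr a) ∧
      HasPow I (Cmd.powers.exec σ) := by
  have key := Cmd.exec_iter_induction (x := 7) (b := 4) (p := .fill 2 (.lit 0) 8 4 .powStep) (σ := σ)
    (fun r τ => Ready I τ ∧ (∀ a ≠ 2, τ.arr a = σ.arr a) ∧ ∀ i < r, i < I.size → τ.arr 2 i = 2 ^ i)
    ⟨h, fun _ _ => rfl, fun i hi => by omega⟩ ?_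
  · rw [h.N] at key
    refine ⟨key.1, key.2.1, fun i hi => ?_⟩
    have := I.t_lt_size
    exact key.2.2 i (by omega) (by omega)
  · rintro r - τ ⟨hτ, ha, hP⟩
    have hτ' := hτ.setVar (x := 7) (by norm_num) r
    refine ⟨hτ'.fill (by norm_num) _ _ _, fun a h1 => ?_, fun i hi hiN => ?_⟩
    · exact (State.fill_arr_of_ne _ h1 _ _ _).trans (ha a h1)
    · have e : ((Cmd.fill 2 (.lit 0) 8 4 .powStep).exec (τ.setVar 7 r)).arr 2 i = _ :=
        State.fill_arr_zero _ _ _ _ (by rwa [hτ'.N])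
      rw [e]
      simp only [Tm.powStep, Tm.eval_ite, Tm.holds_eq, Tm.eval_var, Tm.eval_lit, Tm.eval_add,
        Tm.eval_get, Tm.eval_sub, State.setVar_var, if_true, State.setVar_arr]
      split_ifs with h0
      · rw [h0, pow_zero]
      · obtain ⟨k, rfl⟩ : ∃ k, i = k + 1 := ⟨i - 1, by omega⟩
        rw [Nat.add_sub_cancel, hP k (by omega) (by omega), pow_succ]
        ring

theorem holds_base {σ : State} (h : Ready I σ) (hD : HasDist I σ) (hP : HasPow I σ) {v x y w : ℕ}
    (h7 : σ.var 7 = v) (h9 : σ.var 9 = x) (h10 : σ.var 10 = y) (h11 : σ.var 11 = w)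
    (hv : v ≤ I.n) (hx : x ≤ I.n) (hy : y ≤ I.n) : Tm.base.Holds σ ↔ I.Base v (x, y) w := by
  simp only [Instance.Base, hx, hy, true_and]
  by_cases hvn : v = I.n
  · rw [Tm.base, Tm.holds_ite_of_holds (by simp [h7, h.n, hvn]), if_pos hvn]
    simp [h11]
  have hv' : v < I.n := by omega
  rw [Tm.base, Tm.holds_ite_of_not_holds (by simp [h7, h.n, hvn]), if_neg hvn]
  simp only [Tm.holds_or, Tm.holds_and, Tm.holds_eq, Tm.holds_lt, Tm.holds_not, Tm.holds_sum,
    Tm.holds_imp, Tm.holds_le, Tm.memB, Tm.fam, Tm.dist, Tm.holds_get, Tm.eval_var, Tm.eval_add,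
    Tm.eval_mul, Tm.eval_lit, Tm.eval_get, Tm.eval_ite, State.setVar_var, State.setVar_arr]
  simp only [h7, h9, h10, h11, h.n, h.t, h.m, h.input, Nat.reduceEqDiff, if_false, if_true,
    Instance.input_one]
  refine or_congr (by rw [Instance.input_memB hv']) (and_congr_right fun hx' => and_congr_right fun hy' => ?_)
  rw [hD v hv' x hx', hD v hv' y hy', hD x hx' y hy']
  refine and_congr_right fun _ => exists_congr fun i => and_congr_right fun hi => ?_
  rw [Instance.input_fam hi hx' hy', Instance.input_memB hv', hP i hi.le, hP I.t le_rfl, weight]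

/-- The cell number is decoded by searching for its digits, which are unique by `Instance.code_inj`.
-/
theorem holds_baseEntry {σ : State} (h : Ready I σ) (hD : HasDist I σ) (hP : HasPow I σ) {v x y w : ℕ}
    (h7 : σ.var 7 = v) (hv : v ≤ I.n) (hx : x ≤ I.n) (hy : y ≤ I.n) (hw : w < 4 ^ I.t) :
    Tm.baseEntry.Holds (σ.setVar 8 (I.code x y w)) ↔ I.Base v (x, y) w := by
  have hb : ∀ x' y' w', x' ≤ I.n → y' ≤ I.n → (Tm.base.Holds ((((σ.setVar 8 (I.code x y w)).setVar 9 x').setVar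
      10 y').setVar 11 w') ↔ I.Base v (x', y') w') := fun x' y' w' hx' hy' =>
    holds_base ((((h.setVar (by norm_num) _).setVar (by norm_num) _).setVar (by norm_num) _).setVar
      (by norm_num) _) hD hP (by simp [h7]) (by simp) (by simp) (by simp) hv hx' hy'
  simp only [Tm.baseEntry, Tm.holds_sum, Tm.holds_and, Tm.holds_eq, Tm.code, Tm.eval_var, Tm.eval_add,
    Tm.eval_mul, State.setVar_var]
  simp only [h.m, h.K, Nat.reduceEqDiff, if_false, if_true]
  constructor
  · rintro ⟨x', hx', y', hy', w', hw', he, hh⟩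
    obtain ⟨rfl, rfl, rfl⟩ := (Instance.code_inj (by omega) hw hy' hw').1 he
    exact (hb _ _ _ hx hy).1 hh
  · exact fun hh => ⟨x, by omega, y, by omega, w, hw, rfl, (hb _ _ _ hx hy).2 hh⟩

/-- The constraints `M` for the vertices in `R` are in place. -/
def HasTable (I : Instance) (σ : State) (R : Finset ℕ) (M : ℕ → ℕ × ℕ → ℕ → Prop) : Prop :=
  ∀ v ∈ R, ∀ x ≤ I.n, ∀ y ≤ I.n, ∀ w < 4 ^ I.t,
    (σ.arr 3 (v * I.size + I.code x y w) ≠ 0 ↔ M v (x, y) w)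

theorem exec_constraints {σ : State} (h : Ready I σ) (hD : HasDist I σ) (hP : HasPow I σ) :
    Ready I (Cmd.constraints.exec σ) ∧ (∀ a ≠ 3, (Cmd.constraints.exec σ).arr a = σ.arr a) ∧
      HasTable I (Cmd.constraints.exec σ) (Finset.range (I.n + 1)) I.Base := by
  have key := Cmd.exec_iter_induction (x := 7) (b := 2) (p := .fill 3 (.var 7) 8 4 .baseEntry) (σ := σ)
    (fun r τ => Ready I τ ∧ (∀ a ≠ 3, τ.arr a = σ.arr a) ∧ HasTable I τ (Finset.range r) I.Base)
    ⟨h, fun _ _ => rfl, fun v hv => by simp at hv⟩ ?_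
  · rw [h.m] at key
    exact key
  · rintro r hr τ ⟨hτ, ha, hT⟩
    rw [h.m] at hr
    have hτ' := hτ.setVar (x := 7) (by norm_num) r
    refine ⟨hτ'.fill (by norm_num) _ _ _, fun a h1 => ?_, fun v hv x hx y hy w hw => ?_⟩
    · exact (State.fill_arr_of_ne _ h1 _ _ _).trans (ha a h1)
    · have hc : I.code x y w < I.size := Instance.code_lt (by omega) (by omega) hw
      simp only [Cmd.exec, Tm.eval_var, hτ'.N]
      rw [State.setVar_var, if_pos rfl]
      by_cases hvr : v = r
      · subst hvr
        rw [State.fill_arr_self _ _ _ _ _ hc]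
        refine holds_baseEntry hτ' ?_ ?_ (by simp) (by omega) hx hy hw
        · intro u hu v hv
          rw [← hD u hu v hv, ← ha 1 (by norm_num)]; rfl
        · intro i hi
          rw [← hP i hi, ← ha 2 (by norm_num)]; rfl
      · rw [State.fill_arr_of_row_ne _ _ hvr _ _ hc]
        have := Finset.mem_range.1 hv
        exact hT v (by simp; omega) x hx y hy w hw

/-! ### Elimination of leaves -/

open Classical in
theorem card_filter_forall_le {N : ℕ} {φ : ℕ → Prop} (h : ∃ z < N, φ z) :
    ∃ k < N, φ k ∧ (∀ z < k, ¬ φ z) ∧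
      ((Finset.range N).filter fun y => ¬ ∃ z < N, z ≤ y ∧ φ z).card = k := by
  have h' : ∃ z, φ z := h.imp fun _ => And.right
  have hk : Nat.find h' < N := h.elim fun z hz => (Nat.find_min' h' hz.2).trans_lt hz.1
  -- The numbers with no witness up to them are exactly those below the least witness, so their
  -- count is that witness.
  refine ⟨Nat.find h', hk, Nat.find_spec h', fun z => Nat.find_min h', ?_⟩
  rw [show (Finset.range N).filter (fun y => ¬ ∃ z < N, z ≤ y ∧ φ z) = Finset.range (Nat.find h') from ?_,
    Finset.card_range]
  ext y
  simp only [Finset.mem_filter, Finset.mem_range, not_exists, not_and]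
  refine ⟨fun ⟨_, h2⟩ => ?_, fun hy => ⟨hy.trans hk, fun z _ hzy => Nat.find_min h' (hzy.trans_lt hy)⟩⟩
  by_contra hle
  exact h2 _ hk (by omega) (Nat.find_spec h')

/-- Searching for the least number that satisfies a formula. -/
theorem exec_count_notUpTo {σ : State} (h : Ready I σ) (x : ℕ) {e : Tm} {φ : ℕ → Prop}
    (hφ : ∀ y, ∀ z < I.size, (e.Holds ((σ.setVar 9 y).setVar 10 z) ↔ φ z)) (hex : ∃ z < I.size, φ z) :
    ∃ k < I.size, φ k ∧ (∀ z < k, ¬ φ z) ∧ (Cmd.count x 9 4 (.notUpTo e)).exec σ = σ.setVar x k := by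
  classical
  obtain ⟨k, hk, hk1, hk2, hk3⟩ := card_filter_forall_le hex
  refine ⟨k, hk, hk1, hk2, ?_⟩
  change σ.setVar x ((Tm.card 9 4 (.notUpTo e)).eval σ) = _
  rw [Tm.eval_card, h.N, ← hk3]
  congr 2
  refine Finset.filter_congr fun y _ => ?_
  simp only [Tm.notUpTo, Tm.holds_not, Tm.holds_sum, Tm.holds_and, Tm.holds_le, Tm.eval_var,
    State.setVar_var, if_true, Nat.reduceEqDiff, if_false, h.N]
  exact not_congr (exists_congr fun z => and_congr_right fun hz => and_congr_right fun _ => hφ y z hz)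

/-- The vertices that are not in `R` are marked. -/
def HasMarks (I : Instance) (σ : State) (R : Finset ℕ) : Prop := ∀ z < I.n, (σ.arr 4 z ≠ 0 ↔ z ∉ R)

theorem holds_leaf {σ : State} (h : Ready I σ) {R : Finset ℕ} (hR : R ⊆ Finset.range I.n)
    (hm : HasMarks I σ R) {z : ℕ} (hz : σ.var 10 = z) :
    Tm.leaf.Holds σ ↔ z ∈ R ∧ ∀ w ∈ R, ∀ w' ∈ R, I.Adj z w → I.Adj z w' → w = w' := by
  have hRn : ∀ {w}, w ∈ R → w < I.n := fun hw => Finset.mem_range.1 (hR hw)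
  simp only [Tm.leaf, Tm.holds_and, Tm.holds_lt, Tm.holds_not, Tm.holds_sum, Tm.adj, Tm.holds_get,
    Tm.holds_eq, Tm.eval_var, Tm.eval_add, Tm.eval_mul, Tm.eval_lit, State.setVar_var,
    State.setVar_arr, Nat.reduceEqDiff, if_true, if_false, hz, h.n, h.input]
  constructor
  · rintro ⟨h1, h2, h3⟩
    refine ⟨by simpa using mt (hm z h1).2 h2, fun w hw w' hw' ha ha' => ?_⟩
    by_contra hne
    exact h3 ⟨w, hRn hw, w', hRn hw', fun h => (hm w (hRn hw)).1 h hw, fun h => (hm w' (hRn hw')).1 h hw',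
      (Instance.input_adj h1 (hRn hw)).2 ha, (Instance.input_adj h1 (hRn hw')).2 ha', hne⟩
  · rintro ⟨h1, h2⟩
    refine ⟨hRn h1, fun h => (hm z (hRn h1)).1 h h1, ?_⟩
    rintro ⟨w, hw, w', hw', h3, h4, ha, ha', hne⟩
    exact hne (h2 w (by simpa using mt (hm w hw).2 h3) w' (by simpa using mt (hm w' hw').2 h4)
      ((Instance.input_adj (hRn h1) hw).1 ha) ((Instance.input_adj (hRn h1) hw').1 ha'))

theorem holds_parent {σ : State} (h : Ready I σ) {R : Finset ℕ} (hR : R ⊆ Finset.range I.n)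
    (hm : HasMarks I σ R) {u z : ℕ} (hu : σ.var 5 = u) (hun : u < I.n) (hz : σ.var 10 = z) :
    Tm.parent.Holds σ ↔ z = I.n ∨ z ∈ R ∧ I.Adj u z := by
  simp only [Tm.parent, Tm.holds_or, Tm.holds_and, Tm.holds_lt, Tm.holds_not, Tm.adj, Tm.holds_get,
    Tm.holds_eq, Tm.eval_var, Tm.eval_add, Tm.eval_mul, Tm.eval_lit, hz, hu, h.n, h.input]
  refine or_congr Iff.rfl ⟨fun ⟨h1, h2, h3⟩ => ?_, fun ⟨h1, h2⟩ => ?_⟩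
  · exact ⟨by simpa using mt (hm z h1).2 h2, (Instance.input_adj hun h1).1 h3⟩
  · have hzn := Finset.mem_range.1 (hR h1)
    exact ⟨hzn, fun h => (hm z hzn).1 h h1, (Instance.input_adj hun hzn).2 h2⟩

theorem holds_compat {σ : State} (h : Ready I σ) (hD : HasDist I σ) {u v x y x' y' : ℕ}
    (h5 : σ.var 5 = u) (h6 : σ.var 6 = v) (h9 : σ.var 9 = x) (h10 : σ.var 10 = y)
    (h13 : σ.var 13 = x') (h14 : σ.var 14 = y') (hv : v = I.n ∨ I.Adj v u) :
    Tm.compat.Holds σ ↔ I.Compat v u (x, y) (x', y') := by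
  simp only [Tm.compat, Tm.holds_or, Tm.holds_and, Tm.holds_lt, Tm.holds_imp, Tm.dist, Tm.eval_get,
    Tm.holds_eq, Tm.eval_var, Tm.eval_add, Tm.eval_mul, Tm.eval_lit, h5, h6, h9, h10, h13, h14, h.n, h.m]
  rcases hv with rfl | hv
  · simp only [true_or, true_iff]
    exact fun ha => absurd ha.1 (lt_irrefl _)
  have hvn := hv.1
  have hun := hv.2.1
  rw [or_iff_right hvn.ne, Instance.Compat, imp_iff_right hv]
  simp only [Prod.mk.injEq]
  refine and_congr (imp_congr_right fun hx => ?_) (imp_congr_right fun hx => ?_)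
  · rw [hD u hun x hx, hD v hvn x hx]
  · rw [hD u hun x' hx, hD v hvn x' hx]

/-- Summands of a weight below `4 ^ t` are below `4 ^ t` themselves, so the truncated tables lose
nothing. The bound `hM` on labels makes the search for the label of `u` exhaustive. -/
theorem holds_mergeEntry {σ : State} (h : Ready I σ) (hD : HasDist I σ) {R : Finset ℕ}
    {M : ℕ → ℕ × ℕ → ℕ → Prop} (hT : HasTable I σ R M)
    (hM : ∀ z ∈ R, ∀ l w, M z l w → l.1 ≤ I.n ∧ l.2 ≤ I.n) {u v : ℕ} (hu : u ∈ R) (hv : v ∈ R)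
    (h5 : σ.var 5 = u) (h6 : σ.var 6 = v) (huv : v = I.n ∨ I.Adj v u) {x y w : ℕ} (hx : x ≤ I.n)
    (hy : y ≤ I.n) (hw : w < 4 ^ I.t) :
    Tm.mergeEntry.Holds (σ.setVar 8 (I.code x y w)) ↔ merge I.Compat M u v v (x, y) w := by
  have hcomp : ∀ {τ : State} {x y x' y' : ℕ}, Ready I τ → HasDist I τ → τ.var 5 = u → τ.var 6 = v →
      τ.var 9 = x → τ.var 10 = y → τ.var 13 = x' → τ.var 14 = y' →
      (Tm.compat.Holds τ ↔ I.Compat v u (x, y) (x', y')) := fun h hD h5 h6 h9 h10 h13 h14 =>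
    holds_compat h hD h5 h6 h9 h10 h13 h14 huv
  have hstate : ∀ a b c d e f, Tm.compat.Holds (((((((σ.setVar 8 (I.code x y w)).setVar 9 a).setVar
      10 b).setVar 11 c).setVar 12 d).setVar 13 e).setVar 14 f) ↔ I.Compat v u (a, b) (e, f) :=
    fun a b c d e f => hcomp (((((((h.setVar (by norm_num) _).setVar (by norm_num) _).setVar
      (by norm_num) _).setVar (by norm_num) _).setVar (by norm_num) _).setVar (by norm_num) _).setVar
      (by norm_num) _) hD (by simp [h5]) (by simp [h6]) (by simp) (by simp) (by simp) (by simp)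
  simp only [Tm.mergeEntry, Tm.holds_sum, Tm.holds_and, Tm.holds_eq, Tm.holds_lt, Tm.code, Tm.table,
    Tm.holds_get, Tm.eval_var, Tm.eval_add, Tm.eval_mul, State.setVar_arr, hstate]
  simp only [State.setVar_var, h.m, h.K, h.N, h5, h6, Nat.reduceEqDiff, if_false, if_true, merge]
  constructor
  · rintro ⟨a, ha, b, hb, w₁, hw₁, w₂, hw₂, x', hx', y', hy', hlt, he, hM1, hM2, hc⟩
    obtain ⟨rfl, rfl, rfl⟩ := (Instance.code_inj (by omega) hw hb hlt).1 he
    exact ⟨w₁, w₂, (x', y'), rfl, (hT v hv x hx y hy w₁ hw₁).1 hM1,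
      (hT u hu x' (by omega) y' (by omega) w₂ hw₂).1 hM2, hc⟩
  · rintro ⟨w₁, w₂, ⟨x', y'⟩, rfl, hM1, hM2, hc⟩
    obtain ⟨hx', hy'⟩ := hM u hu _ _ hM2
    exact ⟨x, by omega, y, by omega, w₁, by omega, w₂, by omega, x', Nat.lt_succ_of_le hx', y',
      Nat.lt_succ_of_le hy', hw, rfl, (hT v hv x hx y hy w₁ (by omega)).2 hM1,
      (hT u hu x' hx' y' hy' w₂ (by omega)).2 hM2, hc⟩

/-- The state of the elimination: `R` is the set of vertices that are left. -/
structure Progress (I : Instance) (σ : State) (R : Finset ℕ) (M : ℕ → ℕ × ℕ → ℕ → Prop) : Prop where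
  ready : Ready I σ
  dist : HasDist I σ
  pow : HasPow I σ
  subset : R ⊆ Finset.range I.n
  marks : HasMarks I σ R
  table : HasTable I σ (insert I.n R) M
  label_le : ∀ z ∈ insert I.n R, ∀ l w, M z l w → l.1 ≤ I.n ∧ l.2 ≤ I.n
  isYes : Solvable I.Compat (insert I.n R) M (target I.t) ↔ I.IsYes

theorem exists_leaf {R : Finset ℕ} (hR : R ⊆ Finset.range I.n) (hne : R.Nonempty) :
    ∃ u ∈ R, ∀ w ∈ R, ∀ w' ∈ R, I.Adj u w → I.Adj u w' → w = w' := by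
  classical
  have hRn : ∀ {w}, w ∈ R → w < I.n := fun hw => Finset.mem_range.1 (hR hw)
  let Q : Finset (Fin I.n) := Finset.univ.filter fun v => (v : ℕ) ∈ R
  have hQ : ∀ {v : Fin I.n}, v ∈ Q ↔ (v : ℕ) ∈ R := by simp [Q]
  obtain ⟨r, hr⟩ := hne
  obtain ⟨u, hu, h⟩ := exists_subsingleton_neighbors I.isForest
    (R := Q) ⟨⟨r, hRn hr⟩, hQ.2 hr⟩
  exact ⟨u, hQ.1 hu, fun w hw w' hw' ha ha' =>
    congrArg Fin.val (h ⟨w, hRn hw⟩ (hQ.2 hw) ⟨w', hRn hw'⟩ (hQ.2 hw') ha.2.2 ha'.2.2)⟩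

theorem Progress.eliminate {σ : State} {R : Finset ℕ} {M : ℕ → ℕ × ℕ → ℕ → Prop}
    (h : Progress I σ R M) (hne : R.Nonempty) :
    ∃ u ∈ R, ∃ M', Progress I (Cmd.eliminate.exec σ) (R.erase u) M' := by
  obtain ⟨hready, hD, hP, hR, hm, hT, hM, hY⟩ := h
  have hRn : ∀ {w}, w ∈ R → w < I.n := fun hw => Finset.mem_range.1 (hR hw)
  obtain ⟨u₀, hu₀, hleaf₀⟩ := exists_leaf hR hne
  obtain ⟨u, -, ⟨hu, hleaf⟩, -, eu⟩ := exec_count_notUpTo hready 5 (e := .leaf)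
    (φ := fun z => z ∈ R ∧ ∀ w ∈ R, ∀ w' ∈ R, I.Adj z w → I.Adj z w' → w = w')
    (fun y z _ => holds_leaf ((hready.setVar (by norm_num) _).setVar (by norm_num) _) hR hm (by simp))
    ⟨u₀, (hRn hu₀).trans I.n_lt_size, hu₀, hleaf₀⟩
  have hready1 := hready.setVar (x := 5) (by norm_num) u
  obtain ⟨v, -, hv, hmin, ev⟩ := exec_count_notUpTo hready1 6 (e := .parent)
    (φ := fun z => z = I.n ∨ z ∈ R ∧ I.Adj u z)
    (fun y z _ => holds_parent (u := u) ((hready1.setVar (by norm_num) _).setVar (by norm_num) _) hR hm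
      (by simp) (hRn hu) (by simp)) ⟨I.n, I.n_lt_size, .inl rfl⟩
  have hready2 := hready1.setVar (x := 6) (by norm_num) v
  have huR : u ∈ insert I.n R := Finset.mem_insert_of_mem hu
  have hvR : v ∈ insert I.n R := Finset.mem_insert.2 (hv.imp_right And.left)
  have huv : u ≠ v := by
    rintro rfl
    rcases hv with hv | hv
    · exact (hRn hu).ne hv
    · exact hv.2.2.2.ne rfl
  have hadj : v = I.n ∨ I.Adj v u := hv.imp_right fun h => h.2.symm
  have hexec : Cmd.eliminate.exec σ = (Cmd.fill 4 (.lit 0) 8 4 (.or (.get 4 (.var 8)) (.eq (.var 8) (.var 5)))).exec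
      ((Cmd.fill 3 (.var 6) 8 4 .mergeEntry).exec ((σ.setVar 5 u).setVar 6 v)) := by
    rw [← ev, ← eu]; rfl
  have herase : insert I.n (R.erase u) = (insert I.n R).erase u := by
    rw [Finset.erase_insert_of_ne (hRn hu).ne']
  refine ⟨u, hu, merge I.Compat M u v, ?_⟩
  rw [hexec]
  -- The additional vertex has no neighbors. Since `n` exceeds all vertices, the least candidate is
  -- `v = n` only if `u` has no remaining neighbor; otherwise `v` is the only one.
  have hfree : ∀ z ∈ insert I.n R, z ≠ u → z ≠ v → ∀ l l', I.Compat z u l l' := by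
    intro z hz _ hzv l l' ha
    exfalso
    rcases Finset.mem_insert.1 hz with rfl | hz
    · exact lt_irrefl _ ha.1
    rcases hv with rfl | hv
    · exact hmin z (hRn hz) (.inr ⟨hz, ha.symm⟩)
    · exact hzv (hleaf z hz v hv.1 ha.symm hv.2)
  set τ := (Cmd.fill 3 (.var 6) 8 4 .mergeEntry).exec ((σ.setVar 5 u).setVar 6 v) with hτ
  have hτr : Ready I τ := hready2.fill (by norm_num) _ _ _
  have hτa : ∀ a ≠ 3, τ.arr a = σ.arr a := fun a ha => State.fill_arr_of_ne _ ha _ _ _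
  set τ' := (Cmd.fill 4 (.lit 0) 8 4 (.or (.get 4 (.var 8)) (.eq (.var 8) (.var 5)))).exec τ with hτ'
  have hτ'a : ∀ a ≠ 4, τ'.arr a = τ.arr a := fun a ha => State.fill_arr_of_ne _ ha _ _ _
  refine ⟨hτr.fill (by norm_num) _ _ _, ?_, ?_, (Finset.erase_subset _ _).trans hR, ?_, ?_, ?_, ?_⟩
  · intro a ha b hb
    rw [hτ'a 1 (by norm_num), hτa 1 (by norm_num)]
    exact hD a ha b hb
  · intro i hi
    rw [hτ'a 2 (by norm_num), hτa 2 (by norm_num)]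
    exact hP i hi
  · intro z hz
    have e : τ'.arr 4 z = _ := State.fill_arr_zero _ _ _ _ (by rw [hτr.N]; exact hz.trans I.n_lt_size)
    rw [e]
    change (Tm.or _ _).Holds _ ↔ _
    have e5 : τ.var 5 = u := by simp [hτ, Cmd.exec]
    simp only [Tm.holds_or, Tm.holds_get, Tm.holds_eq, Tm.eval_var, State.setVar_var, if_true,
      State.setVar_arr, Nat.reduceEqDiff, if_false, e5, Finset.mem_erase]
    rw [hτa 4 (by norm_num), hm z hz]
    tauto
  · intro z hz x hx y hy w hw
    rw [herase] at hz
    have hc : I.code x y w < I.size := Instance.code_lt (by omega) (by omega) hw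
    rw [hτ'a 3 (by norm_num)]
    simp only [hτ, Cmd.exec, Tm.eval_var, hready2.N]
    rw [State.setVar_var, if_pos rfl]
    by_cases hzv : z = v
    · subst hzv
      rw [State.fill_arr_self _ _ _ _ _ hc]
      exact holds_mergeEntry hready2 hD hT hM huR hvR (by simp) (by simp) hadj hx hy hw
    · rw [State.fill_arr_of_row_ne _ _ hzv _ _ hc]
      simp only [merge, if_neg hzv]
      exact hT z (Finset.mem_of_mem_erase hz) x hx y hy w hw
  · intro z hz l w hz'
    rw [herase] at hz
    by_cases hzv : z = v
    · simp only [merge, if_pos hzv] at hz'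
      obtain ⟨w₁, w₂, l', -, h1, -⟩ := hz'
      exact hM v hvR _ _ h1
    · simp only [merge, if_neg hzv] at hz'
      exact hM z (Finset.mem_of_mem_erase hz) _ _ hz'
  · rw [herase, solvable_erase_iff (fun _ _ _ _ => Instance.Compat.symm) huR hvR huv hfree, hY]

theorem Progress.setVar {σ : State} {R : Finset ℕ} {M : ℕ → ℕ × ℕ → ℕ → Prop} (h : Progress I σ R M)
    {x : ℕ} (hx : 5 ≤ x) (v : ℕ) : Progress I (σ.setVar x v) R M :=
  ⟨h.ready.setVar hx v, h.dist, h.pow, h.subset, h.marks, h.table, h.label_le, h.isYes⟩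

/-- The target is `2^t * (t + 1) - 1`, and `t + 1 ≤ 2^t`. -/
theorem target_lt (t : ℕ) : target t < 4 ^ t := by
  have h1 : t + 1 ≤ 2 ^ t := Nat.lt_two_pow_self
  have h2 : 2 ^ t * (t + 1) ≤ 2 ^ t * 2 ^ t := Nat.mul_le_mul_left _ h1
  have h3 : (4 : ℕ) ^ t = 2 ^ t * 2 ^ t := by rw [← mul_pow]; norm_num
  have h4 : 0 < 2 ^ t := by positivity
  rw [target, h3]
  rw [mul_add] at h2
  omega

/-- The algorithm is correct. -/
theorem holds_accept {σ : State} (h : Ready I σ) (h1 : ∀ j, σ.arr 1 j = 0) (h4 : ∀ j, σ.arr 4 j = 0) :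
    Tm.accept.Holds (Cmd.main.exec σ) ↔ I.IsYes := by
  obtain ⟨hr1, ha1, hD1⟩ := exec_distances h h1
  obtain ⟨hr2, ha2, hP2⟩ := exec_powers hr1
  have hD2 : HasDist I (Cmd.powers.exec (Cmd.distances.exec σ)) := fun u hu v hv => by
    rw [ha2 1 (by norm_num)]; exact hD1 u hu v hv
  obtain ⟨hr3, ha3, hT3⟩ := exec_constraints hr2 hD2 hP2
  set τ := Cmd.constraints.exec (Cmd.powers.exec (Cmd.distances.exec σ))
  have hins : insert I.n (Finset.range I.n) = Finset.range (I.n + 1) := by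
    rw [Finset.range_add_one]
  have hprog : Progress I τ (Finset.range I.n) I.Base := by
    refine ⟨hr3, fun u hu v hv => ?_, fun i hi => ?_, subset_rfl, fun z hz => ?_, by rwa [hins],
      fun z _ l w hz => ⟨hz.1, hz.2.1⟩, by rw [hins, Instance.isYes_iff]⟩
    · rw [ha3 1 (by norm_num)]; exact hD2 u hu v hv
    · rw [ha3 2 (by norm_num)]; exact hP2 i hi
    · rw [ha3 4 (by norm_num), ha2 4 (by norm_num), ha1 4 (by norm_num), h4]
      simpa using hz
  have key := Cmd.exec_iter_induction (x := 7) (b := 0) (p := .eliminate) (σ := τ)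
    (fun r ρ => ∃ R M, R.card + r = I.n ∧ Progress I ρ R M)
    ⟨_, _, by simp, hprog⟩ fun r hr ρ ⟨R, M, hc, hρ⟩ => by
      rw [hr3.n] at hr
      obtain ⟨u, hu, M', h'⟩ := (hρ.setVar (x := 7) (by norm_num) r).eliminate
        (Finset.card_pos.1 (by omega))
      refine ⟨_, M', ?_, h'⟩
      rw [Finset.card_erase_of_mem hu]
      have := Finset.card_pos.2 ⟨u, hu⟩
      omega
  rw [hr3.n] at key
  obtain ⟨R, M, hc, hρ⟩ := key
  have hmain : Cmd.main.exec σ = (Cmd.iter 7 0 .eliminate).exec τ := rfl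
  rw [hmain]
  set ρ := (Cmd.iter 7 0 .eliminate).exec τ
  -- After `n` eliminations only the additional vertex is left, and its row answers the question
  -- directly.
  obtain rfl : R = ∅ := Finset.card_eq_zero.1 (by omega)
  have htab := hρ.table
  simp only [insert_empty_eq] at htab
  rw [← hρ.isYes, insert_empty_eq]
  simp only [Tm.accept, Tm.table, Tm.code, Tm.holds_sum, Tm.holds_get, Tm.eval_add, Tm.eval_sub, Tm.eval_mul,
    Tm.eval_get, Tm.eval_var, Tm.eval_lit, State.setVar_arr, State.setVar_var, Nat.reduceEqDiff, if_true,
    if_false, hρ.ready.n, hρ.ready.m, hρ.ready.K, hρ.ready.N, hρ.ready.t, hρ.pow I.t le_rfl]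
  constructor
  · rintro ⟨x, hx, y, hy, hh⟩
    refine ⟨fun _ => (x, y), fun _ => target I.t, fun v hv => ?_, fun v hv u hu hvu => ?_, by simp⟩
    · rw [Finset.mem_singleton.1 hv]
      exact (htab I.n (by simp) x (by omega) y (by omega) _ (target_lt _)).1 hh
    · rw [Finset.mem_singleton.1 hv, Finset.mem_singleton.1 hu] at hvu
      exact absurd rfl hvu
  · rintro ⟨g, f, hM, -, hw⟩
    rw [Finset.sum_singleton] at hw
    have h' := hM I.n (by simp)
    obtain ⟨hx, hy⟩ := hρ.label_le I.n (by simp) _ _ h'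
    rw [hw] at h'
    exact ⟨(g I.n).1, by omega, (g I.n).2, by omega,
      (htab I.n (by simp) _ hx _ hy _ (target_lt _)).2 h'⟩

end PathCover

namespace PathCover

/-! ## The program and its running time -/

/-- The computation of the parameters. -/
def setup : Prog :=
  .seq (.assign (2 * 0 + 1) (.get 0 (.lit 0))) (.seq (.assign (2 * 1 + 1) (.get 0 (.lit 2)))
  (.seq (.assign (2 * 2 + 1) (.add (.var (2 * 0 + 1)) (.lit 1))) (.seq (.assign (2 * 3 + 1) (.lit 1))
  (.seq (.assign (2 * 0) (.lit 0)) (.seq (.loop (.lt (.var (2 * 0)) (.var (2 * 1 + 1)))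
    (.seq (.assign (2 * 3 + 1) (.add (.add (.var (2 * 3 + 1)) (.var (2 * 3 + 1)))
        (.add (.var (2 * 3 + 1)) (.var (2 * 3 + 1)))))
      (.assign (2 * 0) (.add (.var (2 * 0)) (.lit 1)))))
  (.seq ((Tm.mul (.mul (.var 3) 2) 2).compile 0) (.assign (2 * 4 + 1) (.var (2 * 0)))))))))

/-- The algorithm for Colorful Path-Cover. -/
def algorithm : Prog :=
  .seq setup (.seq (Cmd.main.compile 0) ((Tm.ite .accept (.lit 1) (.lit 0)).compile 0))

theorem Rep.setVar_odd {s σ : State} (h : Rep s σ) (x v : ℕ) : Rep (s.setVar (2 * x + 1) v) (σ.setVar x v) := by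
  refine ⟨fun y => ?_, h.2⟩
  rw [State.setVar_var, State.setVar_var, h.1]
  exact if_congr (by omega) rfl rfl

theorem Rep.setVar_even {s σ : State} (h : Rep s σ) (x v : ℕ) : Rep (s.setVar (2 * x) v) σ :=
  ⟨fun y => by rw [State.setVar_var, if_neg (by omega), h.1], h.2⟩

variable (I : Instance)

/-- The initial state without the length of the input. -/
noncomputable def inputState : State where
  var := fun _ => 0
  arr := Function.update 0 0 I.input

/-- The length of the input sits in machine variable `0`, which is even and hence invisible to
terms. -/
theorem rep_init : Rep (State.init I.encode) (inputState I) := by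
  refine ⟨fun x => ?_, fun a => ?_⟩
  · simp [State.init, inputState]
  · by_cases h : a = 0 <;> simp [State.init, inputState, h]
    rfl

/-- The state after the computation of the parameters. -/
noncomputable def readyState : State :=
  (((((inputState I).setVar 0 I.n).setVar 1 I.t).setVar 2 (I.n + 1)).setVar 3 (4 ^ I.t)).setVar 4 I.size

theorem ready_readyState : Ready I (readyState I) := by
  constructor <;> simp [readyState, inputState]

theorem readyState_var_le (x : ℕ) : (readyState I).var x ≤ I.size := by
  have h1 := I.n_lt_size
  have h2 := I.t_lt_size
  have h3 := I.pow_le_size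
  have h4 : (inputState I).var x = 0 := rfl
  simp only [readyState, State.setVar_var, h4]
  split_ifs <;> omega

/-- The power `4 ^ t` comes from `t` quadruplings by addition; the remaining factors of `I.size` are
multiplied in by the compiled `mul`. -/
theorem spec_setup : ∃ f, PolyBdd f ∧ ∀ I : Instance,
    setup.Spec (State.init I.encode) (f (I.size + 2)) fun s => Rep s (readyState I) := by
  obtain ⟨f, hf, h⟩ := (Tm.mul (.mul (.var 3) 2) 2).exists_correct
  refine ⟨fun X => 3 + (3 + (4 + (2 + (2 + ((X + 1) * 20 + (f X + 2)))))),
    (PolyBdd.const 3).add ((PolyBdd.const 3).add ((PolyBdd.const 4).add ((PolyBdd.const 2).add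
      ((PolyBdd.const 2).add (((PolyBdd.id.add (.const 1)).mul (.const 20)).add (hf.add (.const 2))))))),
    fun I => ?_⟩
  have hin : ∀ {s σ : State}, Rep s σ → σ.arr = (inputState I).arr → ∀ j, s.arr 0 j = I.input j :=
    fun h hσ j => by
      have := h.2 0
      rw [hσ] at this
      simp only [mul_zero] at this
      rw [this]
      simp [inputState]
  let σ₃ := (((inputState I).setVar 0 I.n).setVar 1 I.t).setVar 2 (I.n + 1)
  refine .seq (.assign (Q := fun s => Rep s ((inputState I).setVar 0 I.n)) ?_) fun s₁ h₁ =>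
    .seq (.assign (Q := fun s => Rep s (((inputState I).setVar 0 I.n).setVar 1 I.t)) ?_) fun s₂ h₂ =>
    .seq (.assign (Q := fun s => Rep s σ₃) ?_) fun s₃ h₃ =>
    .seq (.assign (Q := fun s => Rep s (σ₃.setVar 3 1)) ?_) fun s₄ h₄ =>
    .seq (.assign (Q := fun s => Rep s (σ₃.setVar 3 1) ∧ s.var (2 * 0) = 0) ?_) fun s₅ h₅ =>
    .seq (.mono (.loop (fun i s => Rep s (σ₃.setVar 3 (4 ^ i)) ∧ s.var (2 * 0) = i) I.t 12 ?_ ?_ ?_) ?_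
      fun _ h => h) fun s₆ h₆ => .seq (h 0 _ s₆ _ h₆.1 ?_) fun s₇ h₇ => .assign ?_
  · have := (rep_init I).setVar_odd 0 (Expr.eval (State.init I.encode) (.get 0 (.lit 0)))
    rwa [show Expr.eval (State.init I.encode) (.get 0 (.lit 0)) = I.n from
      hin (rep_init I) rfl 0] at this ⊢
  · have := h₁.setVar_odd 1 (Expr.eval s₁ (.get 0 (.lit 2)))
    rwa [show Expr.eval s₁ (.get 0 (.lit 2)) = I.t from hin h₁ rfl 2] at this ⊢
  · have := h₂.setVar_odd 2 (Expr.eval s₂ (.add (.var (2 * 0 + 1)) (.lit 1)))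
    rwa [show Expr.eval s₂ (.add (.var (2 * 0 + 1)) (.lit 1)) = I.n + 1 by
      simp only [Expr.eval, h₂.1]; simp] at this ⊢
  · exact h₃.setVar_odd 3 1
  · exact ⟨h₄.setVar_even 0 _, by simp [Expr.eval]⟩
  · intro i hi s ⟨hs, h0⟩
    have ht : s.var (2 * 1 + 1) = I.t := by rw [hs.1]; simp [σ₃]
    refine ⟨by simp only [Expr.eval, h0, ht, if_pos hi]; norm_num, .seq (B := 8) (C := 4)
      (.assign (Q := fun s => Rep s (σ₃.setVar 3 (4 ^ (i + 1))) ∧ s.var (2 * 0) = i) ?_)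
      fun s' h' => .assign ?_⟩
    · have h3 : s.var (2 * 3 + 1) = 4 ^ i := by rw [hs.1]; simp
      have := hs.setVar_odd 3 (4 ^ (i + 1))
      rw [State.setVar_setVar] at this
      simp only [Expr.eval, h3]
      rw [show 4 ^ i + 4 ^ i + (4 ^ i + 4 ^ i) = 4 ^ (i + 1) by ring]
      exact ⟨this, by simpa using h0⟩
    · exact ⟨h'.1.setVar_even 0 _, by simpa [Expr.eval] using h'.2⟩
  · intro s ⟨hs, h0⟩
    have ht : s.var (2 * 1 + 1) = I.t := by rw [hs.1]; simp [σ₃]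
    simp only [Expr.eval, h0, ht]
    simp
  · simpa using h₅
  · have := I.t_lt_size
    simp only [Expr.cost]
    exact Nat.mul_le_mul (by omega) (by omega)
  · intro x
    have h1 := I.n_lt_size
    have h2 := I.t_lt_size
    have h3 := I.pow_le_size
    have h4 : (inputState I).var x = 0 := rfl
    simp only [σ₃, State.setVar_var, h4]
    split_ifs <;> omega
  · have e : Expr.eval s₇ (.var (2 * 0)) = I.size := by
      simp only [Expr.eval, h₇.1]
      simp [Tm.eval, σ₃, Instance.size]
    rw [e]
    exact (h₆.1.frame h₇.2).setVar_odd 4 _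

/-- The algorithm halts with the correct answer in time polynomial in `I.size`. -/
theorem spec_algorithm : ∃ d, ∀ I : Instance,
    algorithm.Spec (State.init I.encode) ((I.size + 2) ^ d) fun s => s.var 0 = bit I.IsYes := by
  obtain ⟨f, hf, h⟩ := spec_setup
  obtain ⟨g, hg, h'⟩ := Cmd.main.exists_correct
  obtain ⟨k, hk, h''⟩ := (Tm.ite .accept (.lit 1) (.lit 0)).exists_correct
  obtain ⟨d, hd⟩ := hf.add (hg.add hk)
  refine ⟨d, fun I => .mono (.seq (h I) fun s₁ h₁ => .seq (h' 0 (I.size + 2) s₁ _ h₁ fun x => ?_)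
    fun s₂ h₂ => .mono (h'' 0 (I.size + 2) s₂ _ h₂.1 fun x => ?_) le_rfl fun s₃ h₃ => ?_)
      (hd _ (by omega)) fun _ h => h⟩
  · have := readyState_var_le I x
    omega
  · have := Cmd.main.exec_var_le (readyState_var_le I) x
    omega
  · have h4 := holds_accept (ready_readyState I) (fun j => by simp [readyState, inputState])
      (fun j => by simp [readyState, inputState])
    -- The result register of `compile 0` is the output variable.
    rw [show (0 : ℕ) = 2 * 0 from rfl, h₃.1, Tm.eval_ite, bit]
    by_cases hI : I.IsYes
    · rw [if_pos (h4.2 hI), if_pos hI, Tm.eval_lit]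
    · rw [if_neg (mt h4.1 hI), if_neg hI, Tm.eval_lit]

/-- Here `n + 1 ≤ 2 * max 1 n` gives a factor `4`, and `I.size + 2 ≤ 3 * I.size` a factor `3`. -/
theorem size_add_two_le : I.size + 2 ≤ 12 * 4 ^ I.t * (max 1 I.n) ^ 2 := by
  have h1 : I.n + 1 ≤ 2 * max 1 I.n := by omega
  have h2 : (I.n + 1) * (I.n + 1) ≤ (2 * max 1 I.n) * (2 * max 1 I.n) := Nat.mul_le_mul h1 h1
  have h3 : 1 ≤ I.size := by have := I.n_lt_size; omega
  have h4 := Nat.mul_le_mul_left (4 ^ I.t) h2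
  rw [Instance.size, mul_assoc] at *
  nlinarith

/-- For `k ≤ 1` the exponent `k * log k` vanishes, but `t ≤ a`, so the constant `4 ^ (a * d)`
suffices. For `k ≥ 2` one has `log k ≥ 1/2`, so `2 * a * k * d ≤ 4 * a * d * (k * log k)`. -/
theorem four_pow_le (a k t d C : ℕ) (ht : t ≤ a * k) (hC : 4 * (a * d) ≤ C) :
    (4 : ℝ) ^ (t * d) ≤ 4 ^ (a * d) * (2 : ℝ) ^ ((C : ℝ) * ((k : ℝ) * Real.log (k : ℝ))) := by
  have h1 : ∀ n : ℕ, (1 : ℝ) ≤ 4 ^ n := fun n => one_le_pow₀ (by norm_num)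
  have hlog : 0 ≤ Real.log (k : ℝ) := Real.log_natCast_nonneg k
  have h2 : (1 : ℝ) ≤ (2 : ℝ) ^ ((C : ℝ) * ((k : ℝ) * Real.log (k : ℝ))) :=
    Real.one_le_rpow (by norm_num) (by positivity)
  rcases Nat.lt_or_ge k 2 with hk | hk
  · have : t ≤ a := ht.trans (by nlinarith)
    calc (4 : ℝ) ^ (t * d) ≤ 4 ^ (a * d) :=
          pow_le_pow_right₀ (by norm_num) (Nat.mul_le_mul_right _ this)
      _ ≤ _ := le_mul_of_one_le_right (by positivity) h2
  · have hlk : (1 / 2 : ℝ) ≤ Real.log k := by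
      have := Real.log_two_gt_d9
      have : Real.log 2 ≤ Real.log k := Real.log_le_log (by norm_num) (by exact_mod_cast hk)
      linarith
    refine le_trans ?_ (le_mul_of_one_le_left (by positivity) (h1 _))
    calc (4 : ℝ) ^ (t * d) ≤ 4 ^ (a * k * d) :=
          pow_le_pow_right₀ (by norm_num) (Nat.mul_le_mul_right _ ht)
      _ = (2 : ℝ) ^ ((2 * (a * k * d) : ℕ) : ℝ) := by
          rw [Real.rpow_natCast, show (4 : ℝ) = 2 ^ 2 by norm_num, ← pow_mul]
      _ ≤ _ := Real.rpow_le_rpow_of_exponent_le (by norm_num) ?_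
    have hC' : (4 * (a * d) : ℝ) ≤ C := by exact_mod_cast hC
    push_cast
    calc (2 * (a * k * d) : ℝ) = (4 * (a * d)) * (k * (1 / 2)) := by ring
      _ ≤ C * (k * Real.log k) := by gcongr

end PathCover

theorem lemma7 :
    ∃ (A : PathCover.Prog) (d : ℕ), ∀ a : ℕ, ∃ C : ℕ,
      ∀ (k : ℕ) (I : PathCover.Instance), I.numTrees ≤ a * k → I.t ≤ a * k →
        ∃ (s : PathCover.State) (T : ℕ),
          A.Run (PathCover.State.init I.encode) s T ∧
          s.var 0 = PathCover.bit I.IsYes ∧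
          (T : ℝ) ≤ (C : ℝ) * ((max 1 I.ℓ : ℕ) : ℝ) ^ 2 *
            (2 : ℝ) ^ ((C : ℝ) * ((k : ℝ) * Real.log (k : ℝ))) * ((max 1 I.n : ℕ) : ℝ) ^ d := by
  obtain ⟨d, hd⟩ := PathCover.spec_algorithm
  -- The exponent is doubled because `I.size` is quadratic in `n`. The constant is a sum since it
  -- serves both as a leading factor and in the exponent of `2`.
  refine ⟨PathCover.algorithm, 2 * d, fun a => ⟨12 ^ d * 4 ^ (a * d) + 4 * (a * d), fun k I _ ht => ?_⟩⟩
  obtain ⟨s, T, hrun, hT, hs⟩ := hd I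
  refine ⟨s, T, hrun, hs, ?_⟩
  set C := 12 ^ d * 4 ^ (a * d) + 4 * (a * d) with hC
  have h4 := PathCover.four_pow_le a k I.t d C ht (by omega)
  set E := (2 : ℝ) ^ ((C : ℝ) * ((k : ℝ) * Real.log (k : ℝ)))
  have hE : 0 < E := by positivity
  have hC' : (12 : ℝ) ^ d * 4 ^ (a * d) ≤ C := by
    have : 12 ^ d * 4 ^ (a * d) ≤ C := by omega
    exact_mod_cast this
  have hℓ : (1 : ℝ) ≤ ((max 1 I.ℓ : ℕ) : ℝ) ^ 2 := one_le_pow₀ (by exact_mod_cast le_max_left _ _)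
  have hT' : T ≤ (12 * 4 ^ I.t * (max 1 I.n) ^ 2) ^ d :=
    hT.trans (Nat.pow_le_pow_left (PathCover.size_add_two_le I) d)
  calc (T : ℝ) ≤ ((12 * 4 ^ I.t * (max 1 I.n) ^ 2 : ℕ) : ℝ) ^ d := by exact_mod_cast hT'
    _ = 12 ^ d * 4 ^ (I.t * d) * ((max 1 I.n : ℕ) : ℝ) ^ (2 * d) := by
        rw [Nat.cast_mul, mul_pow, Nat.cast_pow, ← pow_mul, Nat.cast_mul, mul_pow, Nat.cast_pow, ← pow_mul]
        norm_num
    _ ≤ 12 ^ d * (4 ^ (a * d) * E) * ((max 1 I.n : ℕ) : ℝ) ^ (2 * d) := by gcongr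
    _ = (12 ^ d * 4 ^ (a * d)) * 1 * E * ((max 1 I.n : ℕ) : ℝ) ^ (2 * d) := by ring
    _ ≤ C * ((max 1 I.ℓ : ℕ) : ℝ) ^ 2 * E * ((max 1 I.n : ℕ) : ℝ) ^ (2 * d) := by gcongr
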